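/- Let $k$ be a field of characteristic zero and $V$ a $k$-vector space. A pre-Lie algebra is a vector space $X$ with a bilinear product $\star$ whose associator $\Phi(x,y,z)=(x\star y)\star z-x\star(y\star z)$ satisfies $\Phi(x,y,z)=\Phi(x,z,y)$; in a graded pre-Lie algebra the product adds degrees and $\Phi(x,y,z)=(-1)^{|y||z|}\Phi(x,z,y)$ for homogeneous $y,z$. Let $\mathsf{pL}(V)$ be the free pre-Lie algebra generated by $V$, let $\mathsf{pL}(V)_L$ be the Lie algebra on the space $\mathsf{pL}(V)$ with bracket $[x,y]=x\star y-y\star x$, and let $\mathsf{L}(V)\subset\mathsf{pL}(V)_L$ be the Lie subalgebra generated by $V$. Let $\mathsf{pL}(V,\circ)$ be the free graded pre-Lie algebra generated by $V$ placed in degree $0$ and one dummy generator $\circ$ placed in degree $+1$, and let $\mathsf{pL}^n(V)$ be the span of the monomials in it with exactly $n$ occurrences of $\circ$. Let $\mathsf{rpL}^*(V)=\mathsf{pL}(V,\circ)/(\circ\star\circ)$ be its quotient by the ideal generated by $\circ\star\circ$, with the induced grading; then $\mathsf{rpL}^0(V)=\mathsf{pL}(V)$ and $\mathsf{rpL}^1(V)=\mathsf{pL}^1(V)$.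 Let $d:\mathsf{rpL}^*(V)\to\mathsf{rpL}^{*+1}(V)$ be the unique linear map of degree $+1$ such that $d(v)=0$ for $v\in V$, $d(\circ)=0$ and $$d(a\star b)=d(a)\star b+(-1)^{|a|}\,a\star d(b)+\Phi(\circ,a,b)$$ for all $b$ and all homogeneous $a$ in $\mathsf{rpL}^*(V)$. Theorem. The subspace $\mathsf{L}(V)\subset\mathsf{pL}(V)$ equals the kernel of the degree-zero component of $d$: $$\mathsf{L}(V)=\operatorname{Ker}\bigl(d:\mathsf{pL}(V)\to\mathsf{pL}^1(V)\bigr).$$ -/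

import Mathlib

universe u v

noncomputable section

namespace PreLie

/-! ### Quotients of nonassociative algebras by generated ideals -/

section Ideal

variable (k : Type u) [CommRing k] {A : Type v} [NonUnitalNonAssocRing A] [Module k A]

/-- The two-sided ideal of the (nonassociative) `k`-algebra `A` generated by `s`: the smallest
`k`-submodule that contains `s` and is stable under all left and right multiplications. -/
def idealSpan (s : Set A) : Submodule k A :=
  sInf {J | s ⊆ J ∧ ∀ a : A, ∀ x ∈ J, a * x ∈ J ∧ x * a ∈ J}

variable {k}

theorem subset_idealSpan (s : Set A) : s ⊆ idealSpan k s := by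
  intro x hx
  simp only [idealSpan, SetLike.mem_coe, Submodule.mem_sInf]
  exact fun J hJ => hJ.1 hx

theorem idealSpan_le {s : Set A} {J : Submodule k A} (h : s ⊆ J)
    (hm : ∀ a : A, ∀ x ∈ J, a * x ∈ J ∧ x * a ∈ J) : idealSpan k s ≤ J :=
  sInf_le ⟨h, hm⟩

theorem mul_mem_idealSpan {s : Set A} (a : A) {x : A} (hx : x ∈ idealSpan k s) :
    a * x ∈ idealSpan k s := by
  simp only [idealSpan, Submodule.mem_sInf] at hx ⊢
  exact fun J hJ => (hJ.2 a x (hx J hJ)).1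

theorem mem_idealSpan_mul {s : Set A} (a : A) {x : A} (hx : x ∈ idealSpan k s) :
    x * a ∈ idealSpan k s := by
  simp only [idealSpan, Submodule.mem_sInf] at hx ⊢
  exact fun J hJ => (hJ.2 a x (hx J hJ)).2

variable (k)

/-- The quotient algebra of `A` by the two-sided ideal generated by `s`. -/
def AlgQuot (s : Set A) : Type v := A ⧸ idealSpan k s

namespace AlgQuot

variable (s : Set A)

instance : AddCommGroup (AlgQuot k s) := inferInstanceAs (AddCommGroup (A ⧸ idealSpan k s))

instance : Module k (AlgQuot k s) := inferInstanceAs (Module k (A ⧸ idealSpan k s))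

/-- The quotient map. -/
def mk : A →ₗ[k] AlgQuot k s := (idealSpan k s).mkQ

theorem mk_surjective : Function.Surjective (mk k s) := Submodule.mkQ_surjective _

theorem mk_eq_zero {x : A} : mk k s x = 0 ↔ x ∈ idealSpan k s :=
  Submodule.Quotient.mk_eq_zero _

theorem mk_eq_mk {x y : A} : mk k s x = mk k s y ↔ x - y ∈ idealSpan k s :=
  Submodule.Quotient.eq _

/-- A linear map on `A` that vanishes on the ideal descends to the quotient. -/
def liftLin {N : Type*} [AddCommGroup N] [Module k N] (f : A →ₗ[k] N)
    (h : ∀ x ∈ idealSpan k s, f x = 0) : AlgQuot k s →ₗ[k] N :=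
  (idealSpan k s).liftQ f fun x hx => h x hx

@[simp]
theorem liftLin_mk {N : Type*} [AddCommGroup N] [Module k N] (f : A →ₗ[k] N)
    (h : ∀ x ∈ idealSpan k s, f x = 0) (x : A) : liftLin k s f h (mk k s x) = f x := rfl

/-- The product of the quotient algebra: the class of `x` times the class of `y` is the class
of `x * y`. -/
instance : Mul (AlgQuot k s) where
  mul := Quotient.map₂ (· * ·) (by
    intro a b h c d h'
    have h1 : a - b ∈ idealSpan k s := (Submodule.quotientRel_def _).1 h
    have h2 : c - d ∈ idealSpan k s := (Submodule.quotientRel_def _).1 h'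
    refine (Submodule.quotientRel_def _).2 ?_
    have : a * c - b * d = (a - b) * c + b * (c - d) := by
      rw [sub_mul, mul_sub]; abel
    change a * c - b * d ∈ _
    rw [this]
    exact add_mem (mem_idealSpan_mul c h1) (mul_mem_idealSpan b h2))

@[simp]
theorem mk_mul (x y : A) : mk k s (x * y) = mk k s x * mk k s y := rfl

instance : NonUnitalNonAssocRing (AlgQuot k s) where
  left_distrib a b c := by
    obtain ⟨a, rfl⟩ := mk_surjective k s a
    obtain ⟨b, rfl⟩ := mk_surjective k s b
    obtain ⟨c, rfl⟩ := mk_surjective k s c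
    simp only [← mk_mul, ← map_add, mul_add]
  right_distrib a b c := by
    obtain ⟨a, rfl⟩ := mk_surjective k s a
    obtain ⟨b, rfl⟩ := mk_surjective k s b
    obtain ⟨c, rfl⟩ := mk_surjective k s c
    simp only [← mk_mul, ← map_add, add_mul]
  zero_mul a := by
    obtain ⟨a, rfl⟩ := mk_surjective k s a
    rw [← map_zero (mk k s), ← mk_mul, zero_mul]
  mul_zero a := by
    obtain ⟨a, rfl⟩ := mk_surjective k s a
    rw [← map_zero (mk k s), ← mk_mul, mul_zero]

instance [IsScalarTower k A A] : IsScalarTower k (AlgQuot k s) (AlgQuot k s) where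
  smul_assoc r a b := by
    obtain ⟨a, rfl⟩ := mk_surjective k s a
    obtain ⟨b, rfl⟩ := mk_surjective k s b
    simp only [smul_eq_mul, ← map_smul, ← mk_mul, smul_mul_assoc]

instance [SMulCommClass k A A] : SMulCommClass k (AlgQuot k s) (AlgQuot k s) where
  smul_comm r a b := by
    obtain ⟨a, rfl⟩ := mk_surjective k s a
    obtain ⟨b, rfl⟩ := mk_surjective k s b
    simp only [smul_eq_mul, ← map_smul, ← mk_mul, mul_smul_comm]

theorem mk_associator (x y z : A) :
    mk k s (associator x y z) = associator (mk k s x) (mk k s y) (mk k s z) := by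
  simp [associator_apply]

/-- An algebra homomorphism that vanishes on the generators descends to the quotient. -/
def lift [IsScalarTower k A A] [SMulCommClass k A A] {B : Type*} [NonUnitalNonAssocRing B]
    [Module k B] (φ : A →ₙₐ[k] B) (h : ∀ x ∈ s, φ x = 0) : AlgQuot k s →ₙₐ[k] B where
  toFun := liftLin k s (φ : A →ₗ[k] B) (by
    have : idealSpan k s ≤ LinearMap.ker (φ : A →ₗ[k] B) := idealSpan_le
      (fun x hx => by simpa using h x hx)
      (fun a x hx => by
        have hx' : φ x = 0 := by simpa using hx
        simp [hx'])
    exact fun x hx => this hx)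
  map_smul' r x := map_smul _ r x
  map_zero' := map_zero _
  map_add' x y := map_add _ x y
  map_mul' x y := by
    obtain ⟨x, rfl⟩ := mk_surjective k s x
    obtain ⟨y, rfl⟩ := mk_surjective k s y
    rw [← mk_mul]
    exact map_mul φ x y

@[simp]
theorem lift_mk [IsScalarTower k A A] [SMulCommClass k A A] {B : Type*} [NonUnitalNonAssocRing B]
    [Module k B] (φ : A →ₙₐ[k] B) (h : ∀ x ∈ s, φ x = 0) (x : A) :
    lift k s φ h (mk k s x) = φ x := rfl

end AlgQuot

end Ideal

section AssociatorLinear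

variable {k : Type u} [CommRing k] {A : Type v} [NonUnitalNonAssocRing A] [Module k A]

theorem associator_add_left (x x' y z : A) :
    associator (x + x') y z = associator x y z + associator x' y z := by
  simp only [associator_apply, add_mul]; abel

theorem associator_add_mid (x y y' z : A) :
    associator x (y + y') z = associator x y z + associator x y' z := by
  simp only [associator_apply, add_mul, mul_add]; abel

theorem associator_add_right (x y z z' : A) :
    associator x y (z + z') = associator x y z + associator x y z' := by
  simp only [associator_apply, mul_add]; abel

theorem associator_smul_left [IsScalarTower k A A] (r : k) (x y z : A) :
    associator (r • x) y z = r • associator x y z := by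
  simp only [associator_apply, smul_mul_assoc, smul_sub]

theorem associator_smul_mid [IsScalarTower k A A] [SMulCommClass k A A] (r : k) (x y z : A) :
    associator x (r • y) z = r • associator x y z := by
  simp only [associator_apply, smul_mul_assoc, mul_smul_comm, smul_sub]

theorem associator_smul_right [SMulCommClass k A A] (r : k) (x y z : A) :
    associator x y (r • z) = r • associator x y z := by
  simp only [associator_apply, mul_smul_comm, smul_sub]

end AssociatorLinear

/-! ### Monomials in `V` and a dummy generator of degree one -/

section Monomials

variable (k : Type u) [CommRing k] {V : Type v}

/-- Nonassociative monomials in the elements of `V` (`some v`) and the dummy generator `∘`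
(`none`). -/
abbrev Mon (V : Type v) : Type v := FreeMagma (Option V)

/-- The number of occurrences of the dummy generator in a monomial, which is its degree. -/
def deg : Mon V → ℕ
  | FreeMagma.of none => 1
  | FreeMagma.of (some _) => 0
  | FreeMagma.mul x y => deg x + deg y

@[simp] theorem deg_none : deg (FreeMagma.of (none : Option V)) = 1 := rfl
@[simp] theorem deg_some (v : V) : deg (FreeMagma.of (some v)) = 0 := rfl
@[simp] theorem deg_mul (x y : Mon V) : deg (x * y) = deg x + deg y := rfl

/-- A monomial as an element of the free nonassociative algebra. -/
def mono (m : Mon V) : FreeNonUnitalNonAssocAlgebra k (Option V) := MonoidAlgebra.single m 1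

theorem mono_mul (m n : Mon V) : mono k (m * n) = mono k m * mono k n := by
  simp [mono, MonoidAlgebra.single_mul_single]

theorem single_eq (m : Mon V) (r : k) :
    (MonoidAlgebra.single m r : FreeNonUnitalNonAssocAlgebra k (Option V)) = r • mono k m := by
  simp [mono]

end Monomials

variable (k : Type u) [CommRing k] (V : Type v) [AddCommGroup V] [Module k V]

/-! ### The free pre-Lie algebra on a vector space -/

/-- The relations that define the free pre-Lie algebra: linearity of the inclusion of `V`, and
symmetry of the associator in the last two variables. -/
inductive FreePreLieRel : FreeNonUnitalNonAssocAlgebra k V → Prop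
  | add (v w : V) : FreePreLieRel
      (FreeNonUnitalNonAssocAlgebra.of k (v + w) - FreeNonUnitalNonAssocAlgebra.of k v
        - FreeNonUnitalNonAssocAlgebra.of k w)
  | smul (c : k) (v : V) : FreePreLieRel
      (FreeNonUnitalNonAssocAlgebra.of k (c • v) - c • FreeNonUnitalNonAssocAlgebra.of k v)
  | assoc (x y z : FreeNonUnitalNonAssocAlgebra k V) : FreePreLieRel
      (associator x y z - associator x z y)

/-- The free (right) pre-Lie algebra `pL(V)` generated by the vector space `V`. -/
abbrev FreePreLie : Type (max u v) := AlgQuot k {x | FreePreLieRel k V x}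

namespace FreePreLie

instance : RightPreLieRing (FreePreLie k V) where
  assoc_symm' x y z := by
    obtain ⟨x, rfl⟩ := AlgQuot.mk_surjective k _ x
    obtain ⟨y, rfl⟩ := AlgQuot.mk_surjective k _ y
    obtain ⟨z, rfl⟩ := AlgQuot.mk_surjective k _ z
    rw [← AlgQuot.mk_associator, ← AlgQuot.mk_associator, AlgQuot.mk_eq_mk]
    exact subset_idealSpan _ (FreePreLieRel.assoc x y z)

instance : RightPreLieAlgebra k (FreePreLie k V) where

/-- The canonical map `V → pL(V)`. -/
def ι : V →ₗ[k] FreePreLie k V where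
  toFun v := AlgQuot.mk k _ (FreeNonUnitalNonAssocAlgebra.of k v)
  map_add' v w := by
    rw [← map_add, AlgQuot.mk_eq_mk, ← sub_sub]
    exact subset_idealSpan _ (FreePreLieRel.add v w)
  map_smul' c v := by
    rw [RingHom.id_apply, ← map_smul, AlgQuot.mk_eq_mk]
    exact subset_idealSpan _ (FreePreLieRel.smul c v)

end FreePreLie

/-- The Lie algebra `L(V)` of Lie elements: the Lie subalgebra generated by `V` in `pL(V)` with
the commutator bracket `⁅x, y⁆ = x * y - y * x`. -/
def lieElements : LieSubalgebra k (FreePreLie k V) :=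
  LieSubalgebra.lieSpan k (FreePreLie k V) (Set.range (FreePreLie.ι k V))

/-! ### The free graded pre-Lie algebra on `V` and the dummy generator -/

/-- The relations that define the free graded pre-Lie algebra on `V` (in degree `0`) and `∘`
(in degree `1`): linearity of the inclusion of `V`, and graded symmetry of the associator in the
last two variables, `Φ(x, y, z) = (-1) ^ (|y| |z|) Φ(x, z, y)`. -/
inductive GradedRel : FreeNonUnitalNonAssocAlgebra k (Option V) → Prop
  | add (v w : V) : GradedRel
      (mono k (.of (some (v + w))) - mono k (.of (some v)) - mono k (.of (some w)))
  | smul (c : k) (v : V) : GradedRel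
      (mono k (.of (some (c • v))) - c • mono k (.of (some v)))
  | assoc (x y z : Mon V) : GradedRel
      (associator (mono k x) (mono k y) (mono k z)
        - (-1 : k) ^ (deg y * deg z) • associator (mono k x) (mono k z) (mono k y))

/-- The free graded pre-Lie algebra `pL(V, ∘)`. -/
abbrev GradedFree : Type (max u v) := AlgQuot k {x | GradedRel k V x}

namespace GradedFree

variable {V} in
/-- The class of a monomial in `pL(V, ∘)`. -/
def ofMon (m : Mon V) : GradedFree k V := AlgQuot.mk k _ (mono k m)

/-- The dummy generator `∘`. -/
def dummy : GradedFree k V := ofMon k (.of none)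

theorem ofMon_mul (m n : Mon V) : ofMon k (m * n) = ofMon k m * ofMon k n := by
  simp [ofMon, mono_mul]

/-- `pLⁿ(V)`: the span of the monomials with exactly `n` occurrences of the dummy generator. -/
def gr (n : ℕ) : Submodule k (GradedFree k V) :=
  Submodule.span k {x | ∃ m : Mon V, deg m = n ∧ ofMon k m = x}

/-- The canonical map `V → pL(V, ∘)`. -/
def ι : V →ₗ[k] GradedFree k V where
  toFun v := ofMon k (.of (some v))
  map_add' v w := by
    rw [ofMon, ofMon, ofMon, ← map_add, AlgQuot.mk_eq_mk, ← sub_sub]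
    exact subset_idealSpan _ (GradedRel.add v w)
  map_smul' c v := by
    rw [ofMon, ofMon, RingHom.id_apply, ← map_smul, AlgQuot.mk_eq_mk]
    exact subset_idealSpan _ (GradedRel.smul c v)

variable {k V}

theorem ofMon_mem_gr (m : Mon V) : ofMon k m ∈ gr k V (deg m) :=
  Submodule.subset_span ⟨m, rfl, rfl⟩

/-- Induction over linear combinations of monomials. -/
theorem induction_mon {p : GradedFree k V → Prop} (h0 : p 0) (hadd : ∀ x y, p x → p y → p (x + y))
    (hmon : ∀ (r : k) (m : Mon V), p (r • ofMon k m)) (x : GradedFree k V) : p x := by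
  obtain ⟨a, rfl⟩ := AlgQuot.mk_surjective k _ x
  induction a using MonoidAlgebra.induction_linear with
  | zero => simpa using h0
  | add a b ha hb => simpa using hadd _ _ ha hb
  | single m r =>
    rw [single_eq, map_smul]
    exact hmon r m

theorem mul_mem_gr {m n : ℕ} {x y : GradedFree k V} (hx : x ∈ gr k V m) (hy : y ∈ gr k V n) :
    x * y ∈ gr k V (m + n) := by
  induction hx using Submodule.span_induction with
  | zero => simp
  | add a b _ _ ha hb => rw [add_mul]; exact add_mem ha hb
  | smul r a _ ha => rw [smul_mul_assoc]; exact Submodule.smul_mem _ _ ha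
  | mem a ha =>
    obtain ⟨p, rfl, rfl⟩ := ha
    induction hy using Submodule.span_induction with
    | zero => simp
    | add a b _ _ ha hb => rw [mul_add]; exact add_mem ha hb
    | smul r a _ ha => rw [mul_smul_comm]; exact Submodule.smul_mem _ _ ha
    | mem b hb =>
      obtain ⟨q, rfl, rfl⟩ := hb
      rw [← ofMon_mul]
      exact ofMon_mem_gr (p * q)

theorem assoc_mon (x y z : Mon V) : associator (ofMon k x) (ofMon k y) (ofMon k z) =
    (-1 : k) ^ (deg y * deg z) • associator (ofMon k x) (ofMon k z) (ofMon k y) := by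
  have h := (AlgQuot.mk_eq_zero k {x | GradedRel k V x}).2
    (subset_idealSpan _ (GradedRel.assoc x y z))
  rwa [map_sub, map_smul, AlgQuot.mk_associator, AlgQuot.mk_associator, sub_eq_zero] at h

/-- Graded symmetry of the associator of `pL(V, ∘)`. -/
theorem assoc_symm {m n : ℕ} (x : GradedFree k V) {y z : GradedFree k V} (hy : y ∈ gr k V m)
    (hz : z ∈ gr k V n) : associator x y z = (-1 : k) ^ (m * n) • associator x z y := by
  induction x using induction_mon with
  | h0 => simp [associator_apply]
  | hadd x x' hx hx' => rw [associator_add_left, associator_add_left, hx, hx', smul_add]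
  | hmon r p =>
    rw [associator_smul_left, associator_smul_left, smul_comm _ r]
    congr 1
    induction hy using Submodule.span_induction with
    | zero => simp [associator_apply]
    | add a b _ _ ha hb => rw [associator_add_mid, associator_add_right, ha, hb, smul_add]
    | smul r a _ ha => rw [associator_smul_mid, associator_smul_right, ha, smul_comm]
    | mem a ha =>
      obtain ⟨q, rfl, rfl⟩ := ha
      induction hz using Submodule.span_induction with
      | zero => simp [associator_apply]
      | add a b _ _ ha hb => rw [associator_add_mid, associator_add_right, ha, hb, smul_add]
      | smul r a _ ha => rw [associator_smul_mid, associator_smul_right, ha, smul_comm]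
      | mem b hb =>
        obtain ⟨t, rfl, rfl⟩ := hb
        exact assoc_mon p q t

/-! #### The sign automorphism -/

variable (k V)

/-- The images of the generators under the sign automorphism: `v ↦ v` and `∘ ↦ -∘`. -/
def signGen : Option V → GradedFree k V
  | none => -dummy k V
  | some v => ι k V v

/-- The sign automorphism on the free nonassociative algebra. -/
def signAux : FreeNonUnitalNonAssocAlgebra k (Option V) →ₙₐ[k] GradedFree k V :=
  FreeNonUnitalNonAssocAlgebra.lift k (signGen k V)

theorem signAux_mono (m : Mon V) : signAux k V (mono k m) = (-1 : k) ^ deg m • ofMon k m := by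
  induction m using FreeMagma.recOnMul with
  | ih1 g =>
    have : signAux k V (mono k (.of g)) = signGen k V g :=
      FreeNonUnitalNonAssocAlgebra.lift_of_apply k _ g
    rw [this]
    cases g with
    | none => simp [signGen, dummy]
    | some v => simp [signGen, ι]
  | ih2 x y hx hy =>
    rw [mono_mul, map_mul, hx, hy, ofMon_mul, deg_mul, smul_mul_smul_comm, pow_add]

/-- The sign automorphism of `pL(V, ∘)`: multiplication by `(-1) ^ n` in degree `n`. -/
def sign : GradedFree k V →ₙₐ[k] GradedFree k V :=
  AlgQuot.lift k _ (signAux k V) (by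
    intro x hx
    cases hx with
    | add v w =>
      simp only [map_sub, signAux_mono, deg_some, pow_zero, one_smul]
      exact sub_eq_zero.2 (sub_eq_iff_eq_add'.2 ((ι k V).map_add v w))
    | smul c v =>
      simp only [map_sub, map_smul, signAux_mono, deg_some, pow_zero, one_smul]
      exact sub_eq_zero.2 ((ι k V).map_smul c v)
    | assoc x y z =>
      simp only [map_sub, map_smul, associator_apply, map_mul, signAux_mono]
      rw [← associator_apply, ← associator_apply]
      simp only [associator_smul_left, associator_smul_mid, associator_smul_right]
      rw [assoc_mon x y z]
      simp only [smul_smul]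
      rw [← sub_smul]
      convert zero_smul k _ using 2
      ring)

variable {k V}

theorem sign_ofMon (m : Mon V) : sign k V (ofMon k m) = (-1 : k) ^ deg m • ofMon k m :=
  signAux_mono k V m

theorem sign_of_mem {n : ℕ} {x : GradedFree k V} (hx : x ∈ gr k V n) :
    sign k V x = (-1 : k) ^ n • x := by
  induction hx using Submodule.span_induction with
  | zero => simp
  | add a b _ _ ha hb => rw [map_add, ha, hb, smul_add]
  | smul r a _ ha => rw [map_smul, ha, smul_comm]
  | mem a ha =>
    obtain ⟨q, rfl, rfl⟩ := ha
    exact sign_ofMon q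

/-! #### The differential of `pL(V, ∘)` -/

variable (k) in
/-- The differential on monomials, by recursion: it vanishes on the generators, and
`d(x * y) = d(x) * y + (-1) ^ |x| x * d(y) + Φ(∘, x, y)`. -/
def dMon : Mon V → GradedFree k V
  | FreeMagma.of _ => 0
  | FreeMagma.mul x y => dMon x * ofMon k y + (-1 : k) ^ deg x • (ofMon k x * dMon y)
      + associator (dummy k V) (ofMon k x) (ofMon k y)

theorem dMon_mul (x y : Mon V) : dMon k (x * y) =
    dMon k x * ofMon k y + (-1 : k) ^ deg x • (ofMon k x * dMon k y)
      + associator (dummy k V) (ofMon k x) (ofMon k y) := rfl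

theorem dummy_mem : dummy k V ∈ gr k V 1 := ofMon_mem_gr (k := k) (.of (none : Option V))

theorem associator_mem {l m n : ℕ} {x y z : GradedFree k V} (hx : x ∈ gr k V l)
    (hy : y ∈ gr k V m) (hz : z ∈ gr k V n) : associator x y z ∈ gr k V (l + m + n) := by
  rw [associator_apply]
  refine sub_mem (mul_mem_gr (mul_mem_gr hx hy) hz) ?_
  rw [add_assoc]
  exact mul_mem_gr hx (mul_mem_gr hy hz)

theorem dMon_mem (m : Mon V) : dMon k m ∈ gr k V (deg m + 1) := by
  induction m using FreeMagma.recOnMul with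
  | ih1 g => exact zero_mem _
  | ih2 x y hx hy =>
    rw [dMon_mul, deg_mul]
    refine add_mem (add_mem ?_ (Submodule.smul_mem _ _ ?_)) ?_
    · convert mul_mem_gr hx (ofMon_mem_gr y) using 1; congr 1; omega
    · rw [add_assoc]; exact mul_mem_gr (ofMon_mem_gr x) hy
    · convert associator_mem dummy_mem (ofMon_mem_gr x) (ofMon_mem_gr y) using 1; congr 1; omega

variable (k V) in
/-- The linear extension of `dMon` to the free nonassociative algebra. -/
def dAux : FreeNonUnitalNonAssocAlgebra k (Option V) →ₗ[k] GradedFree k V :=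
  (MonoidAlgebra.basis (Mon V) k).constr k (dMon k)

theorem dAux_mono (m : Mon V) : dAux k V (mono k m) = dMon k m :=
  (MonoidAlgebra.basis (Mon V) k).constr_basis k (dMon k) m

theorem dAux_mul (a b : FreeNonUnitalNonAssocAlgebra k (Option V)) :
    dAux k V (a * b) = dAux k V a * AlgQuot.mk k _ b
      + sign k V (AlgQuot.mk k _ a) * dAux k V b
      + associator (dummy k V) (AlgQuot.mk k _ a) (AlgQuot.mk k _ b) := by
  induction a using MonoidAlgebra.induction_linear with
  | zero => simp [associator_apply]
  | add a a' ha ha' =>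
    simp only [add_mul, map_add, associator_add_mid, ha, ha']; abel
  | single m r =>
    rw [single_eq, smul_mul_assoc]
    simp only [map_smul, associator_smul_mid, smul_mul_assoc, ← smul_add]
    congr 1
    induction b using MonoidAlgebra.induction_linear with
    | zero => simp [associator_apply]
    | add a a' ha ha' =>
      simp only [mul_add, map_add, associator_add_right, ha, ha']; abel
    | single n s =>
      rw [single_eq, mul_smul_comm]
      simp only [map_smul, associator_smul_right, mul_smul_comm, ← smul_add]
      congr 1
      rw [← mono_mul, dAux_mono, dAux_mono, dAux_mono, dMon_mul]
      have := sign_ofMon (k := k) m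
      simp only [ofMon] at this ⊢
      rw [this, smul_mul_assoc]

theorem dAux_associator (a b c : FreeNonUnitalNonAssocAlgebra k (Option V)) :
    dAux k V (associator a b c) =
      associator (dAux k V a) (AlgQuot.mk k _ b) (AlgQuot.mk k _ c)
      + associator (sign k V (AlgQuot.mk k _ a)) (dAux k V b) (AlgQuot.mk k _ c)
      + associator (sign k V (AlgQuot.mk k _ a)) (sign k V (AlgQuot.mk k _ b)) (dAux k V c)
      - sign k V (AlgQuot.mk k _ a)
          * associator (dummy k V) (AlgQuot.mk k _ b) (AlgQuot.mk k _ c)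
      + associator (dummy k V * AlgQuot.mk k _ a) (AlgQuot.mk k _ b) (AlgQuot.mk k _ c)
      - dummy k V * associator (AlgQuot.mk k _ a) (AlgQuot.mk k _ b) (AlgQuot.mk k _ c) := by
  simp only [associator_apply, map_sub, dAux_mul, AlgQuot.mk_mul, map_mul, add_mul, mul_add,
    sub_mul, mul_sub]
  abel

theorem dAux_rel {x : FreeNonUnitalNonAssocAlgebra k (Option V)} (hx : GradedRel k V x) :
    dAux k V x = 0 := by
  cases hx with
  | add v w => simp [dAux_mono, dMon]
  | smul c v => simp [dAux_mono, dMon]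
  | assoc x y z =>
    have hsx := sign_ofMon (k := k) x
    have hsy := sign_ofMon (k := k) y
    have hsz := sign_ofMon (k := k) z
    have hx := ofMon_mem_gr (k := k) x
    have hy := ofMon_mem_gr (k := k) y
    have hz := ofMon_mem_gr (k := k) z
    have h1 := assoc_symm (dMon k x) hy hz
    have h2 := assoc_symm (ofMon k x) (dMon_mem y) hz
    have h3 := assoc_symm (ofMon k x) hy (dMon_mem z)
    have h4 := assoc_symm (dummy k V) hy hz
    have h5 := assoc_symm (dummy k V * ofMon k x) hy hz
    have h6 := assoc_symm (ofMon k x) hy hz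
    rw [map_sub, map_smul, dAux_associator, dAux_associator]
    simp only [dAux_mono]
    change associator (dMon k x) (ofMon k y) (ofMon k z)
      + associator (sign k V (ofMon k x)) (dMon k y) (ofMon k z)
      + associator (sign k V (ofMon k x)) (sign k V (ofMon k y)) (dMon k z)
      - sign k V (ofMon k x) * associator (dummy k V) (ofMon k y) (ofMon k z)
      + associator (dummy k V * ofMon k x) (ofMon k y) (ofMon k z)
      - dummy k V * associator (ofMon k x) (ofMon k y) (ofMon k z)
      - (-1 : k) ^ (deg y * deg z) • (associator (dMon k x) (ofMon k z) (ofMon k y)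
      + associator (sign k V (ofMon k x)) (dMon k z) (ofMon k y)
      + associator (sign k V (ofMon k x)) (sign k V (ofMon k z)) (dMon k y)
      - sign k V (ofMon k x) * associator (dummy k V) (ofMon k z) (ofMon k y)
      + associator (dummy k V * ofMon k x) (ofMon k z) (ofMon k y)
      - dummy k V * associator (ofMon k x) (ofMon k z) (ofMon k y)) = 0
    rw [hsx, hsy, hsz]
    simp only [associator_smul_left, associator_smul_mid, smul_mul_assoc, h1, h2, h3, h4, h5, h6,
      mul_smul_comm]
    have e (n : ℕ) : (-1 : k) ^ n * (-1 : k) ^ n = 1 := by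
      rw [← mul_pow]; simp
    have e1 : (-1 : k) ^ ((deg y + 1) * deg z) = (-1) ^ (deg y * deg z) * (-1) ^ deg z := by ring
    have e2 : (-1 : k) ^ deg y * (-1 : k) ^ (deg y * (deg z + 1)) = (-1) ^ (deg y * deg z) := by
      rw [mul_add, pow_add, mul_one, mul_left_comm, e, mul_one]
    rw [e1, smul_comm ((-1 : k) ^ deg y) ((-1 : k) ^ deg x),
      smul_smul ((-1 : k) ^ deg y) ((-1 : k) ^ (deg y * (deg z + 1))), e2]
    module

/-- The differential of `pL(V, ∘)` vanishes on the ideal of relations. -/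
theorem dAux_ideal : ∀ x ∈ idealSpan k {x | GradedRel k V x}, dAux k V x = 0 := by
  have : idealSpan k {x | GradedRel k V x} ≤
      idealSpan k {x | GradedRel k V x} ⊓ LinearMap.ker (dAux k V) := by
    refine idealSpan_le (fun x hx => ⟨subset_idealSpan _ hx, dAux_rel hx⟩) ?_
    rintro a x ⟨hx, hd⟩
    have hx' := (AlgQuot.mk_eq_zero k {x | GradedRel k V x}).2 hx
    have hd' : dAux k V x = 0 := hd
    refine ⟨⟨mul_mem_idealSpan a hx, ?_⟩, ⟨mem_idealSpan_mul a hx, ?_⟩⟩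
    · change dAux k V (a * x) = 0
      rw [dAux_mul, hx', hd']; simp [associator_apply]
    · change dAux k V (x * a) = 0
      rw [dAux_mul, hx', hd']; simp [associator_apply]
  exact fun x hx => (this hx).2

variable (k V) in
/-- The differential of `pL(V, ∘)`. -/
def dTilde : GradedFree k V →ₗ[k] GradedFree k V := AlgQuot.liftLin k _ (dAux k V) dAux_ideal

theorem dTilde_ofMon (m : Mon V) : dTilde k V (ofMon k m) = dMon k m := dAux_mono m

theorem dTilde_mul (x y : GradedFree k V) : dTilde k V (x * y) =
    dTilde k V x * y + sign k V x * dTilde k V y + associator (dummy k V) x y := by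
  obtain ⟨x, rfl⟩ := AlgQuot.mk_surjective k _ x
  obtain ⟨y, rfl⟩ := AlgQuot.mk_surjective k _ y
  exact dAux_mul x y

/-! #### The projections onto the homogeneous components -/

variable (k V) in
/-- The projection onto degree `n`, on the free nonassociative algebra. -/
def projAux (n : ℕ) : FreeNonUnitalNonAssocAlgebra k (Option V) →ₗ[k] GradedFree k V :=
  (MonoidAlgebra.basis (Mon V) k).constr k fun m => if deg m = n then ofMon k m else 0

theorem projAux_mono (n : ℕ) (m : Mon V) :
    projAux k V n (mono k m) = if deg m = n then ofMon k m else 0 :=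
  (MonoidAlgebra.basis (Mon V) k).constr_basis k _ m

theorem projAux_mul (n : ℕ) (a b : FreeNonUnitalNonAssocAlgebra k (Option V)) :
    projAux k V n (a * b) =
      ∑ p ∈ Finset.HasAntidiagonal.antidiagonal n, projAux k V p.1 a * projAux k V p.2 b := by
  induction a using MonoidAlgebra.induction_linear with
  | zero => simp
  | add a a' ha ha' => simp only [add_mul, map_add, ha, ha', Finset.sum_add_distrib]
  | single m r =>
    rw [single_eq, smul_mul_assoc]
    simp only [map_smul, smul_mul_assoc, ← Finset.smul_sum]
    congr 1
    induction b using MonoidAlgebra.induction_linear with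
    | zero => simp
    | add a a' ha ha' => simp only [mul_add, map_add, ha, ha', Finset.sum_add_distrib]
    | single l s =>
      rw [single_eq, mul_smul_comm]
      simp only [map_smul, mul_smul_comm, ← Finset.smul_sum]
      congr 1
      rw [← mono_mul]
      simp only [projAux_mono]
      by_cases h : deg (m * l) = n
      · rw [if_pos h, Finset.sum_eq_single (deg m, deg l)]
        · simp [ofMon_mul]
        · rintro ⟨p, q⟩ _ hne
          dsimp only
          split_ifs with h1 h2
          · subst h1 h2; exact absurd rfl hne
          all_goals simp
        · intro h'
          exact absurd (Finset.HasAntidiagonal.mem_antidiagonal.2 h) h'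
      · rw [if_neg h]
        refine (Finset.sum_eq_zero ?_).symm
        rintro ⟨p, q⟩ hpq
        have := Finset.HasAntidiagonal.mem_antidiagonal.1 hpq
        dsimp only at this ⊢
        split_ifs with h1 h2
        · exact absurd (by rw [deg_mul, h1, h2, this]) h
        all_goals simp

theorem projAux_rel (n : ℕ) {x : FreeNonUnitalNonAssocAlgebra k (Option V)}
    (hx : GradedRel k V x) : projAux k V n x = 0 := by
  cases hx with
  | add v w =>
    have e (u : V) : projAux k V n (mono k (.of (some u))) = if 0 = n then ι k V u else 0 :=
      projAux_mono n _
    simp only [map_sub, e]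
    by_cases hn : 0 = n
    · simp only [if_pos hn]
      exact sub_eq_zero.2 (sub_eq_iff_eq_add'.2 ((ι k V).map_add v w))
    · simp [hn]
  | smul c v =>
    have e (u : V) : projAux k V n (mono k (.of (some u))) = if 0 = n then ι k V u else 0 :=
      projAux_mono n _
    simp only [map_sub, map_smul, e]
    by_cases hn : 0 = n
    · simp only [if_pos hn, sub_self]
    · simp only [if_neg hn, smul_zero, sub_zero]
  | assoc x y z =>
    have h1 : deg (x * y * z) = deg x + deg y + deg z := rfl
    have h2 : deg (x * (y * z)) = deg x + deg y + deg z := (add_assoc _ _ _).symm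
    have h3 : deg (x * z * y) = deg x + deg y + deg z := add_right_comm _ _ _
    have h4 : deg (x * (z * y)) = deg x + deg y + deg z := by
      rw [deg_mul, deg_mul, add_comm (deg z), add_assoc]
    simp only [associator_apply, ← mono_mul, map_sub, map_smul, projAux_mono]
    by_cases hn : deg x + deg y + deg z = n
    · rw [if_pos (h1.trans hn), if_pos (h2.trans hn), if_pos (h3.trans hn), if_pos (h4.trans hn)]
      simp only [ofMon_mul]
      exact sub_eq_zero.2 (assoc_mon x y z)
    · rw [if_neg (h1 ▸ hn), if_neg (h2 ▸ hn), if_neg (h3 ▸ hn), if_neg (h4 ▸ hn)]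
      simp

theorem projAux_ideal (n : ℕ) :
    ∀ x ∈ idealSpan k {x | GradedRel k V x}, projAux k V n x = 0 := by
  have : idealSpan k {x | GradedRel k V x} ≤ ⨅ n, LinearMap.ker (projAux k V n) := by
    refine idealSpan_le (fun x hx => ?_) ?_
    · simp only [SetLike.mem_coe, Submodule.mem_iInf]
      exact fun n => projAux_rel n hx
    · intro a x hx
      simp only [Submodule.mem_iInf, LinearMap.mem_ker] at hx ⊢
      exact ⟨fun n => by rw [projAux_mul]; simp [hx], fun n => by rw [projAux_mul]; simp [hx]⟩
  intro x hx
  have h := this hx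
  simp only [Submodule.mem_iInf, LinearMap.mem_ker] at h
  exact h n

variable (k V) in
/-- The projection of `pL(V, ∘)` onto its component of degree `n`. -/
def proj (n : ℕ) : GradedFree k V →ₗ[k] GradedFree k V :=
  AlgQuot.liftLin k _ (projAux k V n) (projAux_ideal n)

theorem proj_ofMon (n : ℕ) (m : Mon V) :
    proj k V n (ofMon k m) = if deg m = n then ofMon k m else 0 := projAux_mono n m

theorem proj_mul (n : ℕ) (x y : GradedFree k V) :
    proj k V n (x * y) = ∑ p ∈ Finset.HasAntidiagonal.antidiagonal n, proj k V p.1 x * proj k V p.2 y := by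
  obtain ⟨x, rfl⟩ := AlgQuot.mk_surjective k _ x
  obtain ⟨y, rfl⟩ := AlgQuot.mk_surjective k _ y
  exact projAux_mul n x y

theorem proj_of_mem {n : ℕ} {x : GradedFree k V} (hx : x ∈ gr k V n) : proj k V n x = x := by
  induction hx using Submodule.span_induction with
  | zero => simp
  | add a b _ _ ha hb => rw [map_add, ha, hb]
  | smul r a _ ha => rw [map_smul, ha]
  | mem a ha =>
    obtain ⟨q, rfl, rfl⟩ := ha
    rw [proj_ofMon, if_pos rfl]

end GradedFree

/-! ### The reduced graded pre-Lie algebra `rpL(V)` -/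

/-- `rpL(V)`: the quotient of `pL(V, ∘)` by the ideal generated by `∘ * ∘`. -/
abbrev Reduced : Type (max u v) :=
  AlgQuot k ({GradedFree.dummy k V * GradedFree.dummy k V} : Set (GradedFree k V))

namespace Reduced

open GradedFree

/-- The quotient map `pL(V, ∘) → rpL(V)`. -/
def π : GradedFree k V →ₗ[k] Reduced k V := AlgQuot.mk k _

theorem π_surjective : Function.Surjective (π k V) := AlgQuot.mk_surjective k _

/-- The canonical map `V → rpL(V)`. -/
def ι : V →ₗ[k] Reduced k V := π k V ∘ₗ GradedFree.ι k V

/-- The dummy generator `∘` of `rpL(V)`. -/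
def dummy : Reduced k V := π k V (GradedFree.dummy k V)

/-- The homogeneous component `rpLⁿ(V)`. -/
def gr (n : ℕ) : Submodule k (Reduced k V) := (GradedFree.gr k V n).map (π k V)

variable {k V}

theorem π_mul (x y : GradedFree k V) : π k V (x * y) = π k V x * π k V y := rfl

theorem π_eq_zero {x : GradedFree k V} : π k V x = 0 ↔
    x ∈ idealSpan k ({GradedFree.dummy k V * GradedFree.dummy k V} : Set (GradedFree k V)) :=
  AlgQuot.mk_eq_zero k _

theorem π_associator (x y z : GradedFree k V) :
    π k V (associator x y z) = associator (π k V x) (π k V y) (π k V z) :=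
  AlgQuot.mk_associator k _ x y z

theorem dummy_mul_dummy : dummy k V * dummy k V = 0 :=
  π_eq_zero.2 (subset_idealSpan _ rfl)

/-- The sign automorphism and the differential of `pL(V, ∘)` preserve the ideal `(∘ * ∘)`. -/
theorem ideal_stable (x : GradedFree k V) (hx : π k V x = 0) :
    π k V (sign k V x) = 0 ∧ π k V (dTilde k V x) = 0 := by
  have : idealSpan k ({GradedFree.dummy k V * GradedFree.dummy k V} : Set (GradedFree k V)) ≤
      LinearMap.ker (π k V) ⊓ LinearMap.ker (π k V ∘ₗ (sign k V : GradedFree k V →ₗ[k] GradedFree k V))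
        ⊓ LinearMap.ker (π k V ∘ₗ dTilde k V) := by
    refine idealSpan_le ?_ ?_
    · intro x hx
      obtain rfl : x = _ := hx
      have h0 : π k V (GradedFree.dummy k V) * π k V (GradedFree.dummy k V) = 0 := dummy_mul_dummy
      have hs : sign k V (GradedFree.dummy k V) = (-1 : k) ^ 1 • GradedFree.dummy k V :=
        sign_of_mem dummy_mem
      have hd : dTilde k V (GradedFree.dummy k V) = 0 := dTilde_ofMon _
      refine ⟨⟨?_, ?_⟩, ?_⟩
      · change π k V _ = 0
        rw [π_mul, h0]
      · change π k V (sign k V (GradedFree.dummy k V * GradedFree.dummy k V)) = 0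
        rw [map_mul, hs, π_mul, map_smul, smul_mul_smul_comm, h0, smul_zero]
      · change π k V (dTilde k V _) = 0
        rw [dTilde_mul, hd]
        simp [associator_apply, π_mul, h0]
    · rintro a x ⟨⟨h1, h2⟩, h3⟩
      replace h1 : π k V x = 0 := h1
      replace h2 : π k V (sign k V x) = 0 := h2
      replace h3 : π k V (dTilde k V x) = 0 := h3
      refine ⟨⟨⟨?_, ?_⟩, ?_⟩, ⟨⟨?_, ?_⟩, ?_⟩⟩
      · change π k V _ = 0
        rw [π_mul, h1, mul_zero]
      · change π k V (sign k V _) = 0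
        rw [map_mul, π_mul, h2, mul_zero]
      · change π k V (dTilde k V _) = 0
        rw [dTilde_mul]
        simp [associator_apply, π_mul, h1, h3]
      · change π k V _ = 0
        rw [π_mul, h1, zero_mul]
      · change π k V (sign k V _) = 0
        rw [map_mul, π_mul, h2, zero_mul]
      · change π k V (dTilde k V _) = 0
        rw [dTilde_mul]
        simp [associator_apply, π_mul, h1, h2, h3]
  have h := this (π_eq_zero.1 hx)
  exact ⟨h.1.2, h.2⟩

variable (k V) in
/-- The differential `d` of `rpL(V)`, induced by the differential of `pL(V, ∘)`. -/
def d : Reduced k V →ₗ[k] Reduced k V :=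
  AlgQuot.liftLin k _ (π k V ∘ₗ dTilde k V) fun x hx => (ideal_stable x (π_eq_zero.2 hx)).2

theorem d_π (x : GradedFree k V) : d k V (π k V x) = π k V (dTilde k V x) := rfl

theorem d_ι (v : V) : d k V (ι k V v) = 0 := by
  change π k V (dTilde k V (ofMon k _)) = 0
  rw [dTilde_ofMon]; exact map_zero _

theorem d_dummy : d k V (dummy k V) = 0 := by
  change π k V (dTilde k V (ofMon k _)) = 0
  rw [dTilde_ofMon]; exact map_zero _

/-- `d(a * b) = d(a) * b + (-1) ^ |a| a * d(b) + Φ(∘, a, b)`. -/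
theorem d_mul {n : ℕ} {a : Reduced k V} (ha : a ∈ gr k V n) (b : Reduced k V) :
    d k V (a * b) = d k V a * b + (-1 : k) ^ n • (a * d k V b) + associator (dummy k V) a b := by
  obtain ⟨x, hx, rfl⟩ := ha
  obtain ⟨y, rfl⟩ := π_surjective k V b
  rw [← π_mul, d_π, dTilde_mul, sign_of_mem hx]
  rw [map_add, map_add, π_mul, π_mul, π_associator, map_smul, smul_mul_assoc]
  rfl

theorem d_mem {n : ℕ} {a : Reduced k V} (ha : a ∈ gr k V n) : d k V a ∈ gr k V (n + 1) := by
  obtain ⟨x, hx, rfl⟩ := ha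
  rw [d_π]
  refine Submodule.mem_map_of_mem ?_
  induction hx using Submodule.span_induction with
  | zero => simp
  | add a b _ _ ha hb => rw [map_add]; exact add_mem ha hb
  | smul r a _ ha => rw [map_smul]; exact Submodule.smul_mem _ _ ha
  | mem a ha =>
    obtain ⟨q, rfl, rfl⟩ := ha
    rw [dTilde_ofMon]
    exact dMon_mem q

/-- `d` is the only linear map on `rpL(V)` that vanishes on the generators and satisfies the
product rule. -/
theorem d_unique (e : Reduced k V →ₗ[k] Reduced k V) (h1 : ∀ v, e (ι k V v) = 0)
    (h2 : e (dummy k V) = 0)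
    (h3 : ∀ (n : ℕ), ∀ a ∈ gr k V n, ∀ b, e (a * b) =
      e a * b + (-1 : k) ^ n • (a * e b) + associator (dummy k V) a b) : e = d k V := by
  have key (m : Mon V) : e (π k V (ofMon k m)) = d k V (π k V (ofMon k m)) := by
    induction m using FreeMagma.recOnMul with
    | ih1 g =>
      cases g with
      | none => exact h2.trans d_dummy.symm
      | some v => exact (h1 v).trans (d_ι v).symm
    | ih2 x y hx hy =>
      have hm : π k V (ofMon k x) ∈ gr k V (deg x) := Submodule.mem_map_of_mem (ofMon_mem_gr x)
      rw [ofMon_mul, π_mul, h3 _ _ hm, d_mul hm, hx, hy]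
  ext a
  obtain ⟨x, rfl⟩ := π_surjective k V a
  induction x using induction_mon with
  | h0 => simp
  | hadd x y hx hy => simp only [map_add, hx, hy]
  | hmon r m => simp only [map_smul, key]

/-! ### The identifications `pL(V) = rpL⁰(V)` and `pL¹(V) = rpL¹(V)` -/

/-- A homogeneous element of degree at most one in the ideal `(∘ * ∘)` is zero. -/
theorem eq_zero_of_π {n : ℕ} (hn : n ≤ 1) {x : GradedFree k V} (hx : x ∈ GradedFree.gr k V n)
    (h : π k V x = 0) : x = 0 := by
  have : idealSpan k ({GradedFree.dummy k V * GradedFree.dummy k V} : Set (GradedFree k V)) ≤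
      LinearMap.ker (proj k V 0) ⊓ LinearMap.ker (proj k V 1) := by
    refine idealSpan_le ?_ ?_
    · intro x hx
      obtain rfl : x = _ := hx
      have e : GradedFree.dummy k V * GradedFree.dummy k V =
        ofMon k (.of (none : Option V) * .of none) := (ofMon_mul k V _ _).symm
      constructor
      · change proj k V 0 _ = 0
        rw [e, proj_ofMon]; rfl
      · change proj k V 1 _ = 0
        rw [e, proj_ofMon]; rfl
    · rintro a x ⟨h0, h1⟩
      replace h0 : proj k V 0 x = 0 := h0
      replace h1 : proj k V 1 x = 0 := h1
      have e : Finset.HasAntidiagonal.antidiagonal 1 = {((0 : ℕ), 1), (1, 0)} := rfl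
      refine ⟨⟨?_, ?_⟩, ⟨?_, ?_⟩⟩
      · change proj k V 0 _ = 0
        rw [proj_mul]; simp [h0]
      · change proj k V 1 _ = 0
        rw [proj_mul, e]; simp [h0, h1]
      · change proj k V 0 _ = 0
        rw [proj_mul]; simp [h0]
      · change proj k V 1 _ = 0
        rw [proj_mul, e]; simp [h0, h1]
  have hp := this (π_eq_zero.1 h)
  rw [← proj_of_mem hx]
  obtain rfl | rfl : n = 0 ∨ n = 1 := by omega
  · exact hp.1
  · exact hp.2

variable (k V)

/-- The quotient map restricts to an isomorphism `pL¹(V) ≃ rpL¹(V)`. -/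
def equivOne : GradedFree.gr k V 1 ≃ₗ[k] gr k V 1 :=
  LinearEquiv.ofBijective
    ((π k V).restrict (p := GradedFree.gr k V 1) (q := gr k V 1)
      fun _ hx => Submodule.mem_map_of_mem hx)
    ⟨by
      rw [injective_iff_map_eq_zero]
      intro x hx
      exact Subtype.ext (eq_zero_of_π le_rfl x.2 (congrArg Subtype.val hx)), by
      rintro ⟨_, x, hx, rfl⟩
      exact ⟨⟨x, hx⟩, rfl⟩⟩

/-- The canonical homomorphism from the free nonassociative algebra on `V` to `pL(V, ∘)`. -/
def inclAux : FreeNonUnitalNonAssocAlgebra k V →ₙₐ[k] GradedFree k V :=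
  FreeNonUnitalNonAssocAlgebra.lift k (GradedFree.ι k V)

theorem inclAux_mem (x : FreeNonUnitalNonAssocAlgebra k V) :
    inclAux k V x ∈ GradedFree.gr k V 0 := by
  induction x using MonoidAlgebra.induction_linear with
  | zero => simp
  | add a b ha hb => rw [map_add]; exact add_mem ha hb
  | single m r =>
    have e : (MonoidAlgebra.single m r : FreeNonUnitalNonAssocAlgebra k V) =
      r • MonoidAlgebra.single m 1 := by simp
    rw [e, map_smul]
    refine Submodule.smul_mem _ _ ?_
    clear e
    induction m using FreeMagma.recOnMul with
    | ih1 v =>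
      have : inclAux k V (MonoidAlgebra.single (.of v) 1) = GradedFree.ι k V v :=
        FreeNonUnitalNonAssocAlgebra.lift_of_apply k _ v
      rw [this]
      exact ofMon_mem_gr (k := k) (.of (some v))
    | ih2 x y hx hy =>
      have e : (MonoidAlgebra.single (x * y) 1 : FreeNonUnitalNonAssocAlgebra k V) =
        MonoidAlgebra.single x 1 * MonoidAlgebra.single y 1 := by
        simp [MonoidAlgebra.single_mul_single]
      rw [e, map_mul]
      exact mul_mem_gr (m := 0) (n := 0) hx hy

/-- The canonical homomorphism `pL(V) → pL(V, ∘)`. -/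
def incl : FreePreLie k V →ₙₐ[k] GradedFree k V :=
  AlgQuot.lift k _ (inclAux k V) (by
    have hof (v : V) : inclAux k V (FreeNonUnitalNonAssocAlgebra.of k v) = GradedFree.ι k V v :=
      FreeNonUnitalNonAssocAlgebra.lift_of_apply k _ v
    intro x hx
    cases hx with
    | add v w => simp [hof]
    | smul c v => simp [hof]
    | assoc x y z =>
      have h := assoc_symm (inclAux k V x) (inclAux_mem k V y) (inclAux_mem k V z)
      simp only [mul_zero, pow_zero, one_smul] at h
      simp only [associator_apply, map_sub, map_mul] at h ⊢
      rw [h, sub_self])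

theorem incl_mem (x : FreePreLie k V) : incl k V x ∈ GradedFree.gr k V 0 := by
  obtain ⟨x, rfl⟩ := AlgQuot.mk_surjective k _ x
  exact inclAux_mem k V x

/-- The retraction `pL(V, ∘) → pL(V)` on generators: `v ↦ v` and `∘ ↦ 0`. -/
def retrGen : Option V → FreePreLie k V
  | none => 0
  | some v => FreePreLie.ι k V v

/-- The retraction on the free nonassociative algebra. -/
def retrAux : FreeNonUnitalNonAssocAlgebra k (Option V) →ₙₐ[k] FreePreLie k V :=
  FreeNonUnitalNonAssocAlgebra.lift k (retrGen k V)

theorem retrAux_of (g : Option V) : retrAux k V (mono k (.of g)) = retrGen k V g :=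
  FreeNonUnitalNonAssocAlgebra.lift_of_apply k _ g

theorem retrAux_eq_zero (m : Mon V) (hm : deg m ≠ 0) : retrAux k V (mono k m) = 0 := by
  induction m using FreeMagma.recOnMul with
  | ih1 g =>
    cases g with
    | none => exact retrAux_of k V none
    | some v => exact absurd rfl hm
  | ih2 x y hx hy =>
    rw [mono_mul, map_mul]
    by_cases h : deg x = 0
    · rw [hy (fun h' => hm (by rw [deg_mul, h, h'])), mul_zero]
    · rw [hx h, zero_mul]

/-- The retraction `pL(V, ∘) → pL(V)` that sends `∘` to zero. -/
def retr : GradedFree k V →ₙₐ[k] FreePreLie k V :=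
  AlgQuot.lift k _ (retrAux k V) (by
    intro x hx
    cases hx with
    | add v w => simp [retrAux_of, retrGen]
    | smul c v => simp [retrAux_of, retrGen]
    | assoc x y z =>
      simp only [associator_apply, map_sub, map_smul, map_mul]
      by_cases hy : deg y = 0
      · have h := RightPreLieRing.assoc_symm (retrAux k V (mono k x)) (retrAux k V (mono k y))
          (retrAux k V (mono k z))
        simp only [associator_apply] at h
        rw [h, hy, zero_mul, pow_zero, one_smul, sub_self]
      · simp [retrAux_eq_zero k V y hy])

theorem retr_incl (x : FreePreLie k V) : retr k V (incl k V x) = x := by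
  obtain ⟨x, rfl⟩ := AlgQuot.mk_surjective k _ x
  change retr k V (inclAux k V x) = _
  induction x using MonoidAlgebra.induction_linear with
  | zero => simp
  | add a b ha hb => simp only [map_add, ha, hb]
  | single m r =>
    have e : (MonoidAlgebra.single m r : FreeNonUnitalNonAssocAlgebra k V) =
      r • MonoidAlgebra.single m 1 := by simp
    rw [e]
    simp only [map_smul]
    congr 1
    clear e
    induction m using FreeMagma.recOnMul with
    | ih1 v =>
      have : inclAux k V (MonoidAlgebra.single (.of v) 1) = GradedFree.ι k V v :=
        FreeNonUnitalNonAssocAlgebra.lift_of_apply k _ v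
      rw [this]
      exact retrAux_of k V (some v)
    | ih2 x y hx hy =>
      have e : (MonoidAlgebra.single (x * y) 1 : FreeNonUnitalNonAssocAlgebra k V) =
        MonoidAlgebra.single x 1 * MonoidAlgebra.single y 1 := by
        simp [MonoidAlgebra.single_mul_single]
      rw [e, map_mul, map_mul, hx, hy, AlgQuot.mk_mul]

theorem incl_surjOn {x : GradedFree k V} (hx : x ∈ GradedFree.gr k V 0) :
    ∃ y, incl k V y = x := by
  induction hx using Submodule.span_induction with
  | zero => exact ⟨0, map_zero _⟩
  | add a b _ _ ha hb =>
    obtain ⟨a, rfl⟩ := ha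
    obtain ⟨b, rfl⟩ := hb
    exact ⟨a + b, map_add _ _ _⟩
  | smul r a _ ha =>
    obtain ⟨a, rfl⟩ := ha
    exact ⟨r • a, map_smul _ _ _⟩
  | mem a ha =>
    obtain ⟨m, hm, rfl⟩ := ha
    induction m using FreeMagma.recOnMul with
    | ih1 g =>
      cases g with
      | none => exact absurd hm one_ne_zero
      | some v =>
        exact ⟨FreePreLie.ι k V v, FreeNonUnitalNonAssocAlgebra.lift_of_apply k _ v⟩
    | ih2 x y hx hy =>
      rw [deg_mul, Nat.add_eq_zero_iff] at hm
      obtain ⟨a, ha⟩ := hx hm.1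
      obtain ⟨b, hb⟩ := hy hm.2
      exact ⟨a * b, by rw [map_mul, ha, hb, ofMon_mul]⟩

/-- The canonical isomorphism `pL(V) ≃ rpL⁰(V)`, which is the identity on `V`. -/
def equivZero : FreePreLie k V ≃ₗ[k] gr k V 0 :=
  LinearEquiv.ofBijective
    ((π k V ∘ₗ (incl k V : FreePreLie k V →ₗ[k] GradedFree k V)).codRestrict (gr k V 0)
      fun x => Submodule.mem_map_of_mem (incl_mem k V x))
    ⟨by
      rw [injective_iff_map_eq_zero]
      intro x hx
      have h := eq_zero_of_π zero_le_one (incl_mem k V x) (congrArg Subtype.val hx)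
      rw [← retr_incl k V x, h, map_zero], by
      rintro ⟨_, x, hx, rfl⟩
      obtain ⟨y, rfl⟩ := incl_surjOn k V hx
      exact ⟨y, rfl⟩⟩

end Reduced

/-- The map `d : pL(V) → pL¹(V)`: the component `rpL⁰(V) → rpL¹(V)` of the differential of
`rpL(V)`, under the identifications `pL(V) = rpL⁰(V)` and `pL¹(V) = rpL¹(V)`. -/
def d : FreePreLie k V →ₗ[k] GradedFree.gr k V 1 :=
  (Reduced.equivOne k V).symm.toLinearMap
    ∘ₗ (Reduced.d k V).restrict (p := Reduced.gr k V 0) (q := Reduced.gr k V 1)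
      (fun _ hx => Reduced.d_mem hx)
    ∘ₗ (Reduced.equivZero k V).toLinearMap

end PreLie

end

/-!
That `L(V)` lies in the kernel follows from the graded symmetry of `Φ`: in `d [x, y]` the terms
`Φ(∘, x, y)` and `Φ(∘, y, x)` cancel, so `d` is a derivation of the bracket in degree zero.

Conversely, let `M` be a module over the Lie algebra `pL(V)_L`. With `M` in degree one,
`pL(V) ⊕ M` is a graded pre-Lie algebra for the product `(a, m) * (b, n) = (a * b, -⁅b, m⁆)`. So
every `m : M` defines a homomorphism from `pL(V, ∘)` that is the inclusion on `V` and sends `∘` to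
`m`, and if `V` annihilates `m`, this homomorphism sends `d x` to `(0, ⁅x, m⁆)`. Hence every `x` in
the kernel of `d` annihilates `m`. Take for `M` the module induced from the trivial representation
of `L(V)` and for `m` its generator, whose annihilator is exactly `L(V)`. To see the latter,
realize `M` on the polynomials in a basis of `pL(V) / L(V)`, with `m = 1`. The action of `x` is
multiplication by the class of `x` plus a term that does not raise the degree, as in the
Poincaré–Birkhoff–Witt theorem, and that vanishes on `1`.
-/

noncomputable section

namespace InducedModule

open MvPolynomial Module

section Polynomial

variable {k J N : Type*} [CommSemiring k] [AddCommMonoid N] [Module k N]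

theorem map_eq_of_forall_monomial {f f' : MvPolynomial J k →ₗ[k] N} {u : MvPolynomial J k}
    (h : ∀ d ∈ u.support, f (monomial d 1) = f' (monomial d 1)) : f u = f' u := by
  rw [u.as_sum, map_sum, map_sum]
  refine Finset.sum_congr rfl fun d hd => ?_
  rw [← mul_one (coeff d u), ← smul_eq_mul, ← smul_monomial, map_smul, map_smul, h d hd]

theorem map_mem_of_forall_monomial {f : MvPolynomial J k →ₗ[k] N} {P : Submodule k N}
    {u : MvPolynomial J k} (h : ∀ d ∈ u.support, f (monomial d 1) ∈ P) : f u ∈ P := by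
  rw [u.as_sum, map_sum]
  refine sum_mem fun d hd => ?_
  rw [← mul_one (coeff d u), ← smul_eq_mul, ← smul_monomial, map_smul]
  exact P.smul_mem _ (h d hd)

theorem degree_le_of_mem_restrictTotalDegree {n : ℕ} {u : MvPolynomial J k}
    (hu : u ∈ restrictTotalDegree J k n) {d : J →₀ ℕ} (hd : d ∈ u.support) : d.degree ≤ n :=
  (le_totalDegree hd).trans ((mem_restrictTotalDegree J n u).1 hu)

theorem monomial_mem_restrictTotalDegree {n : ℕ} {d : J →₀ ℕ} (hd : d.degree ≤ n) :
    monomial d (1 : k) ∈ restrictTotalDegree J k n :=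
  (monomial_mem_restrictSupport k).2 (.inl hd)

theorem restrictTotalDegree_mono {m n : ℕ} (h : m ≤ n) :
    restrictTotalDegree J k m ≤ restrictTotalDegree J k n :=
  restrictSupport_mono _ fun _ hd => le_trans hd h

theorem support_subset_of_mem_supported {s : Set J} {u : MvPolynomial J k}
    (hu : u ∈ supported k s) {d : J →₀ ℕ} (hd : d ∈ u.support) : ↑d.support ⊆ s :=
  fun _ hi => mem_supported.1 hu (mem_vars_iff_mem_support _ |>.2 ⟨d, hd, hi⟩)

theorem monomial_mem_supported {s : Set J} {d : J →₀ ℕ} (hd : ↑d.support ⊆ s) :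
    monomial d (1 : k) ∈ supported k s := by
  nontriviality k
  rwa [mem_supported, vars_monomial one_ne_zero]

/-- The family of endomorphisms that sends `x : N` and a monomial of exponent `d` to `F d x`. -/
def ofMonomial (F : (J →₀ ℕ) → N →ₗ[k] MvPolynomial J k) : N →ₗ[k] End k (MvPolynomial J k) :=
  ((basisMonomials J k).constr k F).flip

theorem ofMonomial_monomial (F : (J →₀ ℕ) → N →ₗ[k] MvPolynomial J k) (x : N) (d : J →₀ ℕ) :
    ofMonomial F x (monomial d 1) = F d x :=
  LinearMap.congr_fun ((basisMonomials J k).constr_basis k F d) x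

variable [LinearOrder J]

theorem exists_eq_single_add {d : J →₀ ℕ} (hd : d ≠ 0) :
    ∃ (m : J) (t : J →₀ ℕ), ↑t.support ⊆ Set.Ici m ∧ d = Finsupp.single m 1 + t := by
  obtain ⟨m, hm, hmin⟩ := d.support.exists_min_image id (Finsupp.support_nonempty_iff.2 hd)
  have hle : Finsupp.single m 1 ≤ d :=
    Finsupp.single_le_iff.2 (Nat.one_le_iff_ne_zero.2 (Finsupp.mem_support_iff.1 hm))
  exact ⟨m, d - Finsupp.single m 1, fun a ha => hmin a (Finsupp.support_tsub ha),
    (add_tsub_cancel_of_le hle).symm⟩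

theorem min'_support_single_add {m : J} {t : J →₀ ℕ} (ht : ↑t.support ⊆ Set.Ici m)
    (h : (Finsupp.single m 1 + t).support.Nonempty) :
    (Finsupp.single m 1 + t).support.min' h = m := by
  classical
  refine (Finset.min'_eq_iff _ h m).2 ⟨by simp, fun a ha => ?_⟩
  rcases Finset.mem_union.1 (Finsupp.support_add ha) with ha | ha
  · exact (Finset.mem_singleton.1 (Finsupp.support_single_subset ha)).ge
  · exact ht ha

end Polynomial

section Symbol

variable {k g J N : Type*} [CommRing k] [AddCommGroup g] [Module k g] [AddCommGroup N] [Module k N]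
  {L : Submodule k g} (c : Basis J k (g ⧸ L))

/-- A representative in `g` of the basis vector `c j` of `g ⧸ L`. -/
def vec (j : J) : g := (c j).out

theorem mkQ_vec (j : J) : L.mkQ (vec c j) = c j := Submodule.Quotient.mk_out _

/-- The linear polynomial given by the coordinates of `x` modulo `L`. -/
def symbol : g →ₗ[k] MvPolynomial J k := c.constr k X ∘ₗ L.mkQ

theorem symbol_vec (j : J) : symbol c (vec c j) = X j := by
  rw [symbol, LinearMap.comp_apply, mkQ_vec, c.constr_basis]

theorem symbol_eq_zero_iff {x : g} : symbol c x = 0 ↔ x ∈ L := by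
  rw [symbol, LinearMap.comp_apply, c.constr_apply, ← Finsupp.linearCombination_apply,
    map_eq_zero_iff _ (linearIndependent_X J k), LinearEquiv.map_eq_zero_iff,
    Submodule.mkQ_apply, Submodule.Quotient.mk_eq_zero]

theorem map_mem_of_forall_vec {f : g →ₗ[k] N} {P : Submodule k N} (hL : ∀ x ∈ L, f x ∈ P)
    (hvec : ∀ j, f (vec c j) ∈ P) (x : g) : f x ∈ P := by
  have hlift : L.mkQ ∘ₗ c.constr k (vec c) = LinearMap.id :=
    c.ext fun j => by rw [LinearMap.comp_apply, c.constr_basis, mkQ_vec, LinearMap.id_apply]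
  have hsub : x - c.constr k (vec c) (L.mkQ x) ∈ L := by
    rw [← Submodule.Quotient.mk_eq_zero, ← Submodule.mkQ_apply, map_sub, ← LinearMap.comp_apply,
      hlift, LinearMap.id_apply, sub_self]
  have hspan : Submodule.span k (Set.range (vec c)) ≤ P.comap f :=
    Submodule.span_le.2 (Set.range_subset_iff.2 hvec)
  rw [← sub_add_cancel x (c.constr k (vec c) (L.mkQ x)), map_add]
  refine add_mem (hL _ hsub) (hspan ?_)
  rw [← c.constr_range k]
  exact LinearMap.mem_range_self _ _

/-- The projection of `g` that kills `vec c j` for `j ∈ S`, fixes the other representatives and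
fixes `L`. -/
def projAway (S : Set J) : g →ₗ[k] g :=
  LinearMap.id - c.constr k (S.indicator (vec c)) ∘ₗ L.mkQ

theorem projAway_vec_of_mem {S : Set J} {j : J} (hj : j ∈ S) : projAway c S (vec c j) = 0 := by
  simp [projAway, -Submodule.mkQ_apply, mkQ_vec, hj]

theorem projAway_vec_of_notMem {S : Set J} {j : J} (hj : j ∉ S) :
    projAway c S (vec c j) = vec c j := by
  simp [projAway, -Submodule.mkQ_apply, mkQ_vec, hj]

theorem map_projAway {S : Set J} {f : g →ₗ[k] N} (hf : ∀ j ∈ S, f (vec c j) = 0) (x : g) :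
    f (projAway c S x) = f x := by
  have h : f ∘ₗ c.constr k (S.indicator (vec c)) = 0 := c.ext fun j => by
    by_cases hj : j ∈ S <;> simp [hj, hf]
  simpa [projAway] using LinearMap.congr_fun h (L.mkQ x)

theorem projAway_projAway (S : Set J) (x : g) :
    projAway c S (projAway c S x) = projAway c S x :=
  map_projAway c (fun _ hj => projAway_vec_of_mem c hj) x

theorem projAway_of_mem (S : Set J) {x : g} (hx : x ∈ L) : projAway c S x = x := by
  simp [projAway, (Submodule.Quotient.mk_eq_zero L).2 hx]

theorem symbol_projAway_mem (S : Set J) (x : g) : symbol c (projAway c S x) ∈ supported k Sᶜ := by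
  refine map_mem_of_forall_vec c (f := symbol c ∘ₗ projAway c S)
    (P := (supported k Sᶜ).toSubmodule) (fun x hx => ?_) (fun j => ?_) x
  · rw [LinearMap.comp_apply, projAway_of_mem c S hx, (symbol_eq_zero_iff c).2 hx]
    exact zero_mem _
  · by_cases hj : j ∈ S
    · rw [LinearMap.comp_apply, projAway_vec_of_mem c hj, map_zero]
      exact zero_mem _
    · rw [LinearMap.comp_apply, projAway_vec_of_notMem c hj, symbol_vec]
      exact Algebra.subset_adjoin ⟨j, hj, rfl⟩

theorem symbol_mul_mem_supported [LinearOrder J] {m : J} {y : g} (hy : projAway c (Set.Iic m) y = y)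
    {u : MvPolynomial J k} (hu : u ∈ supported k (Set.Ici m)) :
    symbol c y * u ∈ supported k (Set.Ici m) := by
  refine mul_mem (supported_mono (fun i hi => ?_) (hy ▸ symbol_projAway_mem c (Set.Iic m) y)) hu
  exact (not_le.1 hi).le

end Symbol

section Filtration

variable {k g J : Type*} [CommRing k] [AddCommGroup g] [Module k g] {L : Submodule k g}
  (c : Basis J k (g ⧸ L)) (E E' : g →ₗ[k] End k (MvPolynomial J k))

/-- Multiplication by symbols, corrected by `E`. -/
def act : g →ₗ[k] End k (MvPolynomial J k) := LinearMap.mul k (MvPolynomial J k) ∘ₗ symbol c + E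

theorem act_apply (x : g) (u : MvPolynomial J k) : act c E x u = symbol c x * u + E x u := rfl

/-- `E` does not raise the degree, so that `act c E x` is multiplication by the symbol of `x` up
to terms of lower order. -/
def IsFiltered : Prop :=
  ∀ n x, ∀ u ∈ restrictTotalDegree J k n, E x u ∈ restrictTotalDegree J k n

/-- `E` and `E'` agree on the polynomials of degree at most `n`. -/
def AgreeUpTo (n : ℕ) : Prop := ∀ x, ∀ u ∈ restrictTotalDegree J k n, E x u = E' x u

variable {E E'}

theorem AgreeUpTo.mono {m n : ℕ} (h : AgreeUpTo E E' n) (hmn : m ≤ n) : AgreeUpTo E E' m :=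
  fun x u hu => h x u (restrictTotalDegree_mono hmn hu)

theorem AgreeUpTo.act_eq {n : ℕ} (h : AgreeUpTo E E' n) (x : g) {u : MvPolynomial J k}
    (hu : u ∈ restrictTotalDegree J k n) : act c E x u = act c E' x u := by
  rw [act_apply, act_apply, h x u hu]

theorem symbol_mem_restrictTotalDegree (x : g) :
    symbol c x ∈ restrictTotalDegree J k 1 := by
  refine map_mem_of_forall_vec c (fun x hx => ?_) (fun j => ?_) x
  · rw [(symbol_eq_zero_iff c).2 hx]
    exact zero_mem _
  · rw [symbol_vec]
    exact monomial_mem_restrictTotalDegree (Finsupp.degree_single j 1).le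

theorem IsFiltered.act_mem (hE : IsFiltered E) (x : g) {n : ℕ} {u : MvPolynomial J k}
    (hu : u ∈ restrictTotalDegree J k n) : act c E x u ∈ restrictTotalDegree J k (n + 1) := by
  refine add_mem ?_ (restrictTotalDegree_mono n.le_succ (hE n x u hu))
  have hx := symbol_mem_restrictTotalDegree c x
  rw [mem_restrictTotalDegree] at hx hu ⊢
  exact (totalDegree_mul _ _).trans (by omega)

end Filtration

section Correction

variable {k g J : Type*} [CommRing k] [LieRing g] [LieAlgebra k g] [LinearOrder J]
  {L : Submodule k g} (c : Basis J k (g ⧸ L))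

/-- The correction forced by a correction `E` in lower degrees if `act` is to be a representation:
on the product of a minimal variable `X m` and a monomial `t`, the part `y` of `x` that comes after
`vec c m` has to satisfy `y • (vec c m • t) = vec c m • (y • t) + ⁅y, vec c m⁆ • t`, while the rest
of `x` just multiplies by its symbol. -/
def next (E : g →ₗ[k] End k (MvPolynomial J k)) : g →ₗ[k] End k (MvPolynomial J k) :=
  ofMonomial fun d =>
    if h : d.support.Nonempty then
      let m := d.support.min' h
      let t : MvPolynomial J k := monomial (d - Finsupp.single m 1) 1
      (act c E (vec c m) ∘ₗ E.flip t - (act c E).flip t ∘ₗ LieAlgebra.ad k g (vec c m))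
        ∘ₗ projAway c (Set.Iic m)
    else 0

variable {E E' : g →ₗ[k] End k (MvPolynomial J k)}

theorem next_one (x : g) : next c E x 1 = 0 := by
  rw [← map_one C, ← monomial_zero', next, ofMonomial_monomial, dif_neg (by simp),
    LinearMap.zero_apply]

theorem next_X_mul_monomial {m : J} {t : J →₀ ℕ} (ht : ↑t.support ⊆ Set.Ici m) (x : g) :
    next c E x (monomial (Finsupp.single m 1 + t) 1) =
      act c E (vec c m) (E (projAway c (Set.Iic m) x) (monomial t 1))
        + act c E ⁅projAway c (Set.Iic m) x, vec c m⁆ (monomial t 1) := by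
  have h : (Finsupp.single m 1 + t).support.Nonempty :=
    Finsupp.support_nonempty_iff.2 fun h => by simpa using DFunLike.congr_fun h m
  rw [next, ofMonomial_monomial, dif_pos h, min'_support_single_add ht h]
  dsimp only
  rw [add_tsub_cancel_left, ← lie_skew, map_neg, LinearMap.neg_apply, ← sub_eq_add_neg]
  rfl

theorem IsFiltered.next (hE : IsFiltered E) : IsFiltered (next c E) := by
  intro n x u hu
  refine map_mem_of_forall_monomial fun d hd => ?_
  have hdn := degree_le_of_mem_restrictTotalDegree hu hd
  rcases eq_or_ne d 0 with rfl | hd0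
  · rw [monomial_zero', map_one, next_one]
    exact zero_mem _
  · obtain ⟨m, t, ht, rfl⟩ := exists_eq_single_add hd0
    rw [map_add, Finsupp.degree_single, add_comm] at hdn
    have htmem := monomial_mem_restrictTotalDegree (k := k) (le_refl t.degree)
    rw [next_X_mul_monomial c ht]
    exact restrictTotalDegree_mono hdn
      (add_mem (hE.act_mem c _ (hE _ _ _ htmem)) (hE.act_mem c _ htmem))

theorem agreeUpTo_zero_next : AgreeUpTo 0 (next c E) 0 := by
  intro x u hu
  refine map_eq_of_forall_monomial fun d hd => ?_
  obtain rfl : d = 0 :=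
    (Finsupp.degree_eq_zero_iff d).1 (Nat.le_zero.1 (degree_le_of_mem_restrictTotalDegree hu hd))
  rw [monomial_zero', map_one, next_one, LinearMap.zero_apply, LinearMap.zero_apply]

theorem AgreeUpTo.next {n : ℕ} (h : AgreeUpTo E E' n) (hE : IsFiltered E) :
    AgreeUpTo (next c E) (next c E') (n + 1) := by
  intro x u hu
  refine map_eq_of_forall_monomial fun d hd => ?_
  have hdn := degree_le_of_mem_restrictTotalDegree hu hd
  rcases eq_or_ne d 0 with rfl | hd0
  · rw [monomial_zero', map_one, next_one, next_one]
  · obtain ⟨m, t, ht, rfl⟩ := exists_eq_single_add hd0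
    rw [map_add, Finsupp.degree_single, add_comm, Nat.add_le_add_iff_right] at hdn
    have htmem := monomial_mem_restrictTotalDegree (k := k) hdn
    rw [next_X_mul_monomial c ht, next_X_mul_monomial c ht, ← h _ _ htmem,
      h.act_eq c _ (hE _ _ _ htmem), h.act_eq c _ htmem]

/-- The `n`-th approximation of the correction, which is exact in degrees at most `n`. -/
def approx (n : ℕ) : g →ₗ[k] End k (MvPolynomial J k) := (next c)^[n] 0

theorem approx_succ (n : ℕ) : approx c (n + 1) = next c (approx c n) :=
  Function.iterate_succ_apply' _ _ _

theorem isFiltered_approx (n : ℕ) : IsFiltered (approx c n) := by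
  induction n with
  | zero => exact fun _ _ _ _ => zero_mem _
  | succ n ih => exact approx_succ c n ▸ ih.next c

theorem agreeUpTo_approx_succ (n : ℕ) : AgreeUpTo (approx c n) (approx c (n + 1)) n := by
  induction n with
  | zero => exact agreeUpTo_zero_next c
  | succ n ih =>
    rw [approx_succ c n, approx_succ c (n + 1)]
    exact ih.next c (isFiltered_approx c _)

theorem agreeUpTo_approx {m n : ℕ} (h : m ≤ n) : AgreeUpTo (approx c m) (approx c n) m := by
  induction n, h using Nat.le_induction with
  | base => exact fun _ _ _ => rfl
  | succ n hmn ih => exact fun x u hu =>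
      (ih x u hu).trans ((agreeUpTo_approx_succ c n).mono hmn x u hu)

/-- The common value of the approximations, a fixed point of `next`. -/
def correction : g →ₗ[k] End k (MvPolynomial J k) :=
  ofMonomial fun d => (approx c d.degree).flip (monomial d 1)

theorem agreeUpTo_correction (n : ℕ) : AgreeUpTo (correction c) (approx c n) n := by
  intro x u hu
  refine map_eq_of_forall_monomial fun d hd => ?_
  have hdn := degree_le_of_mem_restrictTotalDegree hu hd
  rw [correction, ofMonomial_monomial, LinearMap.flip_apply]
  exact agreeUpTo_approx c hdn x _ (monomial_mem_restrictTotalDegree le_rfl)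

theorem isFiltered_correction : IsFiltered (correction c) := fun n x u hu =>
  agreeUpTo_correction c n x u hu ▸ isFiltered_approx c n n x u hu

theorem next_correction : next c (correction c) = correction c := by
  refine LinearMap.ext fun x => LinearMap.ext fun u => ?_
  have hu := (mem_restrictTotalDegree J u.totalDegree u).2 le_rfl
  have hu' := restrictTotalDegree_mono (Nat.le_succ _) hu
  rw [(agreeUpTo_correction c u.totalDegree).next c (isFiltered_correction c) x u hu',
    ← approx_succ, agreeUpTo_correction c _ x u hu']

theorem correction_one (x : g) : correction c x 1 = 0 := by rw [← next_correction, next_one]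

theorem correction_vec {j : J} {u : MvPolynomial J k} (hu : u ∈ supported k (Set.Ici j)) :
    correction c (vec c j) u = 0 := by
  refine map_eq_of_forall_monomial (f' := 0) fun d hd => ?_
  rcases eq_or_ne d 0 with rfl | hd0
  · exact correction_one c _
  · have hsupp := support_subset_of_mem_supported hu hd
    obtain ⟨m, t, ht, rfl⟩ := exists_eq_single_add hd0
    have hjm : j ≤ m := hsupp (by simp)
    rw [← next_correction, next_X_mul_monomial c ht, projAway_vec_of_mem c (S := Set.Iic m) hjm]
    simp

theorem correction_X_mul {m : J} {y : g} (hy : projAway c (Set.Iic m) y = y)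
    {u : MvPolynomial J k} (hu : u ∈ supported k (Set.Ici m)) :
    correction c y (X m * u) = act c (correction c) (vec c m) (correction c y u)
      + act c (correction c) ⁅y, vec c m⁆ u := by
  refine map_eq_of_forall_monomial (f := correction c y ∘ₗ LinearMap.mulLeft k (X m))
    (f' := act c (correction c) (vec c m) ∘ₗ correction c y
      + act c (correction c) ⁅y, vec c m⁆) fun d hd => ?_
  have h := next_X_mul_monomial c (E := correction c) (support_subset_of_mem_supported hu hd) y
  rw [next_correction, hy] at h
  simpa [X, monomial_mul] using h

end Correction

section Action

variable {k g J : Type*} [CommRing k] [LieRing g] [LieAlgebra k g] [LinearOrder J]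

section Submodule

variable {L : Submodule k g} (c : Basis J k (g ⧸ L))

/-- The action of `g` on the module induced from the trivial representation of `L`. The latter is
realized on polynomials, `vec c j₁ • ⋯ • vec c jₙ • 1` being `X j₁ * ⋯ * X jₙ` for
`j₁ ≤ ⋯ ≤ jₙ`. -/
def action : g →ₗ[k] End k (MvPolynomial J k) := act c (correction c)

theorem action_apply (x : g) (u : MvPolynomial J k) :
    action c x u = symbol c x * u + correction c x u := rfl

theorem action_one (x : g) : action c x 1 = symbol c x := by
  rw [action_apply, correction_one, mul_one, add_zero]

theorem action_vec {j : J} {u : MvPolynomial J k} (hu : u ∈ supported k (Set.Ici j)) :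
    action c (vec c j) u = X j * u := by
  rw [action_apply, symbol_vec, correction_vec c hu, add_zero]

theorem action_X_mul {m : J} {y : g} (hy : projAway c (Set.Iic m) y = y)
    {u : MvPolynomial J k} (hu : u ∈ supported k (Set.Ici m)) :
    action c y (X m * u) = action c (vec c m) (action c y u) + action c ⁅y, vec c m⁆ u := by
  rw [action_apply c y, action_apply c y, correction_X_mul c hy hu, map_add,
    action_vec c (symbol_mul_mem_supported c hy hu), mul_left_comm, add_assoc]
  rfl

/-- The failure of `action` to be a representation. -/
def defect : g →ₗ[k] g →ₗ[k] End k (MvPolynomial J k) :=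
  LinearMap.mk₂ k (fun x y => action c x * action c y - action c y * action c x - action c ⁅x, y⁆)
    (fun x x' y => by simp only [map_add, add_lie, add_mul, mul_add]; abel)
    (fun r x y => by simp only [map_smul, smul_lie, smul_mul_assoc, mul_smul_comm, smul_sub])
    (fun x y y' => by simp only [map_add, lie_add, add_mul, mul_add]; abel)
    (fun r x y => by simp only [map_smul, lie_smul, smul_mul_assoc, mul_smul_comm, smul_sub])

theorem defect_apply (x y : g) (u : MvPolynomial J k) :
    defect c x y u = action c x (action c y u) - action c y (action c x u) - action c ⁅x, y⁆ u :=
  rfl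

theorem defect_self (x : g) (u : MvPolynomial J k) : defect c x x u = 0 := by
  rw [defect_apply, lie_self, map_zero, sub_self, LinearMap.zero_apply, sub_zero]

theorem defect_skew (x y : g) (u : MvPolynomial J k) : -defect c y x u = defect c x y u := by
  rw [defect_apply, defect_apply, ← lie_skew x y, map_neg, LinearMap.neg_apply]
  abel

theorem defect_vec_of_projAway_eq {m : J} {y : g} (hy : projAway c (Set.Iic m) y = y)
    {u : MvPolynomial J k} (hu : u ∈ supported k (Set.Ici m)) : defect c y (vec c m) u = 0 := by
  rw [defect_apply, action_vec c hu, action_X_mul c hy hu]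
  abel

theorem defect_vec_right (x : g) {j : J} {u : MvPolynomial J k}
    (hu : u ∈ supported k (Set.Ici j)) : defect c x (vec c j) u = 0 := by
  have hlow : ∀ i ∈ Set.Iic j, ((defect c).flip (vec c j)).flip u (vec c i) = 0 := fun i hi => by
    rw [LinearMap.flip_apply, LinearMap.flip_apply]
    rcases (Set.mem_Iic.1 hi).eq_or_lt with rfl | hij
    · exact defect_self c _ u
    · rw [← defect_skew, defect_vec_of_projAway_eq c (projAway_vec_of_notMem c (not_le.2 hij))
        (supported_mono (Set.Ici_subset_Ici.2 hi) hu), neg_zero]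
  exact (map_projAway c hlow x).symm.trans
    (defect_vec_of_projAway_eq c (projAway_projAway c _ x) hu)

theorem defect_vec_left (x : g) {j : J} {u : MvPolynomial J k}
    (hu : u ∈ supported k (Set.Ici j)) : defect c (vec c j) x u = 0 := by
  rw [← defect_skew, defect_vec_right c x hu, neg_zero]

theorem defect_projAway {m : J} (x y : g) {u : MvPolynomial J k}
    (hu : u ∈ supported k (Set.Ici m)) :
    defect c (projAway c (Set.Iic m) x) (projAway c (Set.Iic m) y) u = defect c x y u := by
  have hu' {j : J} (hj : j ∈ Set.Iic m) : u ∈ supported k (Set.Ici j) :=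
    supported_mono (Set.Ici_subset_Ici.2 hj) hu
  have hleft (y : g) : defect c (projAway c (Set.Iic m) x) y u = defect c x y u :=
    map_projAway c (f := ((defect c).flip y).flip u)
      (fun _ hj => defect_vec_left c y (hu' hj)) x
  have hright : defect c x (projAway c (Set.Iic m) y) u = defect c x y u :=
    map_projAway c (f := (defect c x).flip u) (fun _ hj => defect_vec_right c x (hu' hj)) y
  rw [hleft, hright]

/-- Expanding the action on `X m * u` leaves terms that match by the Jacobi identity in `g` and the
induction hypothesis. -/
theorem defect_X_mul {m : J} {y z : g} (hy : projAway c (Set.Iic m) y = y)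
    (hz : projAway c (Set.Iic m) z = z) {n : ℕ}
    (ih : ∀ x y, ∀ u ∈ restrictTotalDegree J k n, defect c x y u = 0) {u : MvPolynomial J k}
    (hu : u ∈ supported k (Set.Ici m)) (hun : u ∈ restrictTotalDegree J k n) :
    defect c y z (X m * u) = 0 := by
  have hvec {x x' : g} (hx' : projAway c (Set.Iic m) x' = x') :
      defect c x (vec c m) (action c x' u) = 0 := by
    rw [action_apply, map_add, defect_vec_right c x (symbol_mul_mem_supported c hx' hu),
      ih _ _ _ (isFiltered_correction c n x' u hun), add_zero]
  have hyz := hvec (x := y) hz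
  have hzy := hvec (x := z) hy
  have hy' := ih y ⁅z, vec c m⁆ u hun
  have hz' := ih z ⁅y, vec c m⁆ u hun
  have hm := congrArg (action c (vec c m)) (ih y z u hun)
  have hm' := ih ⁅y, z⁆ (vec c m) u hun
  have jacobi : action c ⁅⁅y, z⁆, vec c m⁆ u =
      action c ⁅y, ⁅z, vec c m⁆⁆ u - action c ⁅z, ⁅y, vec c m⁆⁆ u := by
    rw [lie_lie, map_sub, LinearMap.sub_apply]
  rw [defect_apply, action_X_mul c hy hu, action_X_mul c hz hu, ← action_vec c hu]
  simp only [defect_apply, map_add, map_sub, map_zero] at hyz hzy hy' hz' hm hm' ⊢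
  rw [jacobi] at hm'
  linear_combination (norm := module) hyz - hzy + hy' - hz' + hm - hm'

end Submodule

variable {L : LieSubalgebra k g} (c : Basis J k (g ⧸ L.toSubmodule))

theorem defect_one (x y : g) : defect c x y 1 = 0 := by
  refine map_mem_of_forall_vec c (f := (defect c x).flip 1) (P := ⊥) (fun y hy => ?_)
    (fun j => defect_vec_right c x (one_mem _)) y
  refine map_mem_of_forall_vec c (f := ((defect c).flip y).flip 1) (P := ⊥) (fun x hx => ?_)
    (fun j => defect_vec_left c y (one_mem _)) x
  have hone {z : g} (hz : z ∈ L) : action c z 1 = 0 := by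
    rw [action_one, (symbol_eq_zero_iff c).2 hz]
  rw [LinearMap.flip_apply, LinearMap.flip_apply, defect_apply, hone hx, hone hy,
    hone (L.lie_mem hx hy), map_zero, map_zero, sub_zero, sub_zero]
  exact zero_mem _

theorem defect_of_mem_restrictTotalDegree (n : ℕ) (x y : g) {u : MvPolynomial J k}
    (hu : u ∈ restrictTotalDegree J k n) : defect c x y u = 0 := by
  induction n generalizing x y u with
  | zero =>
    refine map_eq_of_forall_monomial (f' := 0) fun d hd => ?_
    obtain rfl : d = 0 :=
      (Finsupp.degree_eq_zero_iff d).1 (Nat.le_zero.1 (degree_le_of_mem_restrictTotalDegree hu hd))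
    exact defect_one c x y
  | succ n ih =>
    refine map_eq_of_forall_monomial (f' := 0) fun d hd => ?_
    have hdn := degree_le_of_mem_restrictTotalDegree hu hd
    rcases eq_or_ne d 0 with rfl | hd0
    · exact defect_one c x y
    · obtain ⟨m, t, ht, rfl⟩ := exists_eq_single_add hd0
      rw [map_add, Finsupp.degree_single, add_comm, Nat.add_le_add_iff_right] at hdn
      have htsupp := monomial_mem_supported (k := k) ht
      have hprod : monomial (Finsupp.single m 1 + t) (1 : k) = X m * monomial t 1 := by
        rw [X, monomial_mul, one_mul]
      rw [hprod, LinearMap.zero_apply, ← defect_projAway c x y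
        (mul_mem (Algebra.subset_adjoin ⟨m, Set.self_mem_Ici, rfl⟩) htsupp)]
      exact defect_X_mul c (projAway_projAway c _ x) (projAway_projAway c _ y)
        (fun x y u hu => ih x y hu) htsupp (monomial_mem_restrictTotalDegree hdn)

theorem action_lie (x y : g) (u : MvPolynomial J k) :
    action c ⁅x, y⁆ u = action c x (action c y u) - action c y (action c x u) :=
  (sub_eq_zero.1 (defect_of_mem_restrictTotalDegree c u.totalDegree x y
    ((mem_restrictTotalDegree J _ u).2 le_rfl))).symm

end Action

open Classical in
theorem exists_lieModule_annihilator_eq {k : Type u} {g : Type v} [CommRing k] [LieRing g]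
    [LieAlgebra k g] (L : LieSubalgebra k g) [Module.Free k (g ⧸ L.toSubmodule)] :
    ∃ (M : Type (max u v)) (_ : AddCommGroup M) (_ : Module k M) (_ : LieRingModule g M)
      (_ : LieModule k g M) (m : M), ∀ x : g, ⁅x, m⁆ = 0 ↔ x ∈ L := by
  let J := Module.Free.ChooseBasisIndex k (g ⧸ L.toSubmodule)
  let c : Basis J k (g ⧸ L.toSubmodule) := Module.Free.chooseBasis k (g ⧸ L.toSubmodule)
  let : LinearOrder J := linearOrderOfSTO WellOrderingRel
  let : LieRingModule g (MvPolynomial J k) :=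
    { bracket := fun x u => action c x u
      add_lie := fun x y u => by rw [map_add, LinearMap.add_apply]
      lie_add := fun x => map_add (action c x)
      leibniz_lie := fun x y u => by rw [action_lie, sub_add_cancel] }
  have : LieModule k g (MvPolynomial J k) :=
    { smul_lie := fun r x => LinearMap.congr_fun (map_smul (action c) r x)
      lie_smul := fun r x u => map_smul (action c x) r u }
  exact ⟨MvPolynomial J k, inferInstance, inferInstance, inferInstance, inferInstance, 1,
    fun x => (action_one c x ▸ symbol_eq_zero_iff c : action c x 1 = 0 ↔ x ∈ L)⟩

end InducedModule

namespace PreLie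

section Differential

variable {k : Type u} [CommRing k] {V : Type v} [AddCommGroup V] [Module k V]

theorem FreePreLie.induction {p : FreePreLie k V → Prop} (hι : ∀ v, p (FreePreLie.ι k V v))
    (hadd : ∀ x y, p x → p y → p (x + y)) (hsmul : ∀ (r : k) x, p x → p (r • x))
    (hmul : ∀ x y, p x → p y → p (x * y)) (x : FreePreLie k V) : p x := by
  obtain ⟨x, rfl⟩ := AlgQuot.mk_surjective k _ x
  induction x using MonoidAlgebra.induction_linear with
  | zero => simpa only [map_zero, zero_smul] using hsmul 0 _ (hι 0)
  | add a b ha hb => rw [map_add]; exact hadd _ _ ha hb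
  | single m r =>
    rw [← mul_one r, ← smul_eq_mul, ← MonoidAlgebra.smul_single, map_smul]
    refine hsmul _ _ ?_
    induction m using FreeMagma.recOnMul with
    | ih1 v => exact hι v
    | ih2 x y hx hy =>
      rw [← mul_one (1 : k), ← MonoidAlgebra.single_mul_single, AlgQuot.mk_mul]
      exact hmul _ _ hx hy

theorem incl_ι (v : V) : Reduced.incl k V (FreePreLie.ι k V v) = GradedFree.ι k V v :=
  FreeNonUnitalNonAssocAlgebra.lift_of_apply k _ v

theorem GradedFree.dTilde_mem {n : ℕ} {x : GradedFree k V} (hx : x ∈ gr k V n) :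
    dTilde k V x ∈ gr k V (n + 1) := by
  refine (Submodule.span_le (p := (gr k V (n + 1)).comap (dTilde k V))).2 ?_ hx
  rintro _ ⟨m, rfl, rfl⟩
  rw [SetLike.mem_coe, Submodule.mem_comap, dTilde_ofMon]
  exact dMon_mem m

theorem coe_d (x : FreePreLie k V) :
    (d k V x : GradedFree k V) = GradedFree.dTilde k V (Reduced.incl k V x) :=
  congrArg Subtype.val ((Reduced.equivOne k V).symm_apply_apply
    ⟨_, GradedFree.dTilde_mem (Reduced.incl_mem k V x)⟩)

theorem coe_d_mul (x y : FreePreLie k V) :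
    (d k V (x * y) : GradedFree k V) = d k V x * Reduced.incl k V y + Reduced.incl k V x * d k V y
      + associator (GradedFree.dummy k V) (Reduced.incl k V x) (Reduced.incl k V y) := by
  simp only [coe_d, map_mul, GradedFree.dTilde_mul]
  rw [GradedFree.sign_of_mem (Reduced.incl_mem k V x), pow_zero, one_smul]

theorem d_ι (v : V) : d k V (FreePreLie.ι k V v) = 0 := by
  rw [← Subtype.val_inj, coe_d, incl_ι]
  exact GradedFree.dTilde_ofMon _

theorem coe_d_lie (x y : FreePreLie k V) :
    (d k V ⁅x, y⁆ : GradedFree k V) =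
      (d k V x * Reduced.incl k V y - Reduced.incl k V y * d k V x)
        + (Reduced.incl k V x * d k V y - d k V y * Reduced.incl k V x) := by
  have hsymm := GradedFree.assoc_symm (GradedFree.dummy k V) (Reduced.incl_mem k V x)
    (Reduced.incl_mem k V y)
  rw [mul_zero, pow_zero, one_smul] at hsymm
  have hlie : ⁅x, y⁆ = x * y - y * x := rfl
  rw [hlie, map_sub, Submodule.coe_sub, coe_d_mul, coe_d_mul, hsymm]
  abel

theorem lieElements_le_ker_d : (lieElements k V).toSubmodule ≤ LinearMap.ker (d k V) := by
  let K : LieSubalgebra k (FreePreLie k V) :=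
    { LinearMap.ker (d k V) with
      lie_mem' := fun {x y} (hx : d k V x = 0) (hy : d k V y = 0) => Subtype.ext <| by
        rw [coe_d_lie, hx, hy]
        simp }
  exact LieSubalgebra.lieSpan_le (K := K).2 (Set.range_subset_iff.2 d_ι)

end Differential

section UniversalProperty

variable {k : Type u} [CommRing k] {V : Type v} [AddCommGroup V] [Module k V]
  {B : Type*} [NonUnitalNonAssocRing B] [Module k B]

/-- The submodules `G n` are the homogeneous components of a graded pre-Lie algebra, except that
they need not span `B` nor be independent. -/
structure IsGradedPreLie (G : ℕ → Submodule k B) : Prop where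
  mul_mem : ∀ {m n : ℕ} {x y : B}, x ∈ G m → y ∈ G n → x * y ∈ G (m + n)
  associator_symm : ∀ {l m n : ℕ} {x y z : B}, x ∈ G l → y ∈ G m → z ∈ G n →
    associator x y z = (-1 : k) ^ (m * n) • associator x z y

variable [IsScalarTower k B B] [SMulCommClass k B B] {G : ℕ → Submodule k B}
  (f : V →ₗ[k] B) (b : B)

/-- The homomorphism on the free nonassociative algebra that underlies `GradedFree.lift`. -/
def GradedFree.liftAux : FreeNonUnitalNonAssocAlgebra k (Option V) →ₙₐ[k] B :=
  FreeNonUnitalNonAssocAlgebra.lift k fun g => g.elim b f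

variable {f b}

theorem GradedFree.liftAux_of (g : Option V) : liftAux f b (mono k (.of g)) = g.elim b f :=
  FreeNonUnitalNonAssocAlgebra.lift_of_apply k _ g

theorem GradedFree.liftAux_mono_mem (hG : IsGradedPreLie G) (hf : ∀ v, f v ∈ G 0) (hb : b ∈ G 1)
    (w : Mon V) : liftAux f b (mono k w) ∈ G (deg w) := by
  induction w using FreeMagma.recOnMul with
  | ih1 g =>
    rw [liftAux_of]
    cases g with
    | none => exact hb
    | some v => exact hf v
  | ih2 x y hx hy =>
    rw [mono_mul, map_mul, deg_mul]
    exact hG.mul_mem hx hy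

variable (hG : IsGradedPreLie G) (hf : ∀ v, f v ∈ G 0) (hb : b ∈ G 1)

/-- The universal property of `pL(V, ∘)`: the homomorphism of graded pre-Lie algebras that extends
`f` and sends `∘` to `b`. -/
def GradedFree.lift : GradedFree k V →ₙₐ[k] B :=
  AlgQuot.lift k _ (liftAux f b) fun x hx => by
    have hmem := liftAux_mono_mem hG hf hb
    cases hx with
    | add v w =>
      simp only [map_sub, liftAux_of, Option.elim_some, map_add]
      abel
    | smul c v => simp only [map_sub, map_smul, liftAux_of, Option.elim_some, sub_self]
    | assoc x y z =>
      have h := hG.associator_symm (hmem x) (hmem y) (hmem z)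
      simp only [associator_apply, map_sub, map_smul, map_mul] at h ⊢
      exact sub_eq_zero.2 h

theorem GradedFree.lift_dummy : lift hG hf hb (dummy k V) = b := liftAux_of none

theorem GradedFree.lift_ι (v : V) : lift hG hf hb (ι k V v) = f v := liftAux_of (some v)

end UniversalProperty

/-- The extension of a pre-Lie algebra `A` by a module `M` over its Lie algebra, with the product
`(a, m) * (b, n) = (a * b, -⁅b, m⁆)`. -/
def SquareZero (A M : Type*) : Type _ := A × M

namespace SquareZero

section Module

variable {A M : Type*} [AddCommGroup A] [AddCommGroup M]

instance : AddCommGroup (SquareZero A M) := inferInstanceAs (AddCommGroup (A × M))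

/-- The component in `A`. -/
def fst : SquareZero A M →+ A := AddMonoidHom.fst A M

/-- The component in `M`. -/
def snd : SquareZero A M →+ M := AddMonoidHom.snd A M

@[ext]
theorem ext {x y : SquareZero A M} (hfst : fst x = fst y) (hsnd : snd x = snd y) : x = y :=
  Prod.ext hfst hsnd

variable (k : Type*) [CommRing k] [Module k A] [Module k M]

instance : Module k (SquareZero A M) := inferInstanceAs (Module k (A × M))

/-- The inclusion `a ↦ (a, 0)`. -/
def inl : A →ₗ[k] SquareZero A M := LinearMap.inl k A M

/-- The inclusion `m ↦ (0, m)`. -/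
def inr : M →ₗ[k] SquareZero A M := LinearMap.inr k A M

variable {k}

@[simp] theorem fst_smul (r : k) (x : SquareZero A M) : fst (r • x) = r • fst x := rfl

@[simp] theorem snd_smul (r : k) (x : SquareZero A M) : snd (r • x) = r • snd x := rfl

@[simp] theorem fst_inl (a : A) : fst (inl k a : SquareZero A M) = a := rfl

@[simp] theorem snd_inl (a : A) : snd (inl k a : SquareZero A M) = 0 := rfl

@[simp] theorem fst_inr (m : M) : fst (inr k m : SquareZero A M) = 0 := rfl

@[simp] theorem snd_inr (m : M) : snd (inr k m : SquareZero A M) = m := rfl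

variable (A M k) in
/-- The grading of `A ⊕ M` that puts `A` in degree `0` and `M` in degree `1`. -/
def gr (n : ℕ) : Submodule k (SquareZero A M) where
  carrier := {x | (n ≠ 0 → fst x = 0) ∧ (n ≠ 1 → snd x = 0)}
  zero_mem' := by simp
  add_mem' hx hy := by simp +contextual [hx.1, hx.2, hy.1, hy.2]
  smul_mem' r x hx := by simp +contextual [hx.1, hx.2]

theorem inl_mem_gr (a : A) : (inl k a : SquareZero A M) ∈ gr A M k 0 := by simp [gr]

theorem inr_mem_gr (m : M) : (inr k m : SquareZero A M) ∈ gr A M k 1 := by simp [gr]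

end Module

section Ring

variable {A M : Type*} [RightPreLieRing A] [AddCommGroup M] [LieRingModule A M]

instance : Mul (SquareZero A M) where
  mul x y := (fst x * fst y, -⁅fst y, snd x⁆)

@[simp] theorem fst_mul (x y : SquareZero A M) : fst (x * y) = fst x * fst y := rfl

@[simp] theorem snd_mul (x y : SquareZero A M) : snd (x * y) = -⁅fst y, snd x⁆ := rfl

instance : NonUnitalNonAssocRing (SquareZero A M) where
  left_distrib a b c := by ext <;> simp [mul_add, add_comm]
  right_distrib a b c := by ext <;> simp [add_mul, add_comm]
  zero_mul a := by ext <;> simp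
  mul_zero a := by ext <;> simp

theorem fst_associator (x y z : SquareZero A M) :
    fst (associator x y z) = associator (fst x) (fst y) (fst z) := by
  simp [associator_apply]

theorem snd_associator (x y z : SquareZero A M) :
    snd (associator x y z) = ⁅fst z, ⁅fst y, snd x⁆⁆ + ⁅fst y * fst z, snd x⁆ := by
  simp [associator_apply]

instance : RightPreLieRing (SquareZero A M) where
  assoc_symm' x y z := by
    ext
    · rw [fst_associator, fst_associator, RightPreLieRing.assoc_symm]
    · have hlie : ⁅fst y, fst z⁆ = fst y * fst z - fst z * fst y := rfl
      have hsnd := leibniz_lie (fst y) (fst z) (snd x)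
      rw [hlie, sub_lie] at hsnd
      rw [snd_associator, snd_associator, hsnd]
      abel

theorem associator_eq_zero (x : SquareZero A M) {y z : SquareZero A M} (hy : fst y = 0)
    (hz : fst z = 0) : associator x y z = 0 := by
  ext
  · simp [associator_apply, hy, hz]
  · simp [snd_associator, hy, hz]

end Ring

section Algebra

variable {k A M : Type*} [CommRing k] [RightPreLieRing A] [RightPreLieAlgebra k A]
  [AddCommGroup M] [Module k M] [LieRingModule A M]

theorem inl_mul (a b : A) : (inl k (a * b) : SquareZero A M) = inl k a * inl k b := by
  ext <;> simp

theorem isGradedPreLie_gr : IsGradedPreLie (gr A M k) where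
  mul_mem {m n x y} hx hy := by
    refine ⟨fun hmn => ?_, fun hmn => ?_⟩
    · rcases eq_or_ne m 0 with rfl | hm
      · rw [fst_mul, hy.1 (by omega), mul_zero]
      · rw [fst_mul, hx.1 hm, zero_mul]
    · rcases eq_or_ne n 0 with rfl | hn
      · rw [snd_mul, hx.2 hmn, lie_zero, neg_zero]
      · rw [snd_mul, hy.1 hn, zero_lie, neg_zero]
  associator_symm {l m n x y z} _ hy hz := by
    by_cases h : m * n = 0
    · rw [h, pow_zero, one_smul, RightPreLieRing.assoc_symm]
    · obtain ⟨hm, hn⟩ := mul_ne_zero_iff.1 h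
      rw [associator_eq_zero x (hy.1 hm) (hz.1 hn), associator_eq_zero x (hz.1 hn) (hy.1 hm),
        smul_zero]

variable [LieModule k A M]

instance : IsScalarTower k (SquareZero A M) (SquareZero A M) where
  smul_assoc r x y := by ext <;> simp [smul_mul_assoc]

instance : SMulCommClass k (SquareZero A M) (SquareZero A M) where
  smul_comm r x y := by ext <;> simp [mul_smul_comm]

end Algebra

section Differential

variable {k : Type u} [CommRing k] {V : Type v} [AddCommGroup V] [Module k V] {M : Type*}
  [AddCommGroup M] [Module k M] [LieRingModule (FreePreLie k V) M] [LieModule k (FreePreLie k V) M]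

/-- The homomorphism `pL(V, ∘) → pL(V) ⊕ M` that extends the inclusion of `V` in `pL(V)` and sends
`∘` to `m`. -/
def homOfDummy (m : M) : GradedFree k V →ₙₐ[k] SquareZero (FreePreLie k V) M :=
  GradedFree.lift (f := inl k ∘ₗ FreePreLie.ι k V) isGradedPreLie_gr (fun _ => inl_mem_gr _)
    (inr_mem_gr m)

theorem homOfDummy_dummy (m : M) : homOfDummy m (GradedFree.dummy k V) = inr k m :=
  GradedFree.lift_dummy _ _ _

theorem homOfDummy_incl (m : M) (x : FreePreLie k V) :
    homOfDummy m (Reduced.incl k V x) = inl k x := by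
  induction x using FreePreLie.induction with
  | hι v => rw [incl_ι]; exact GradedFree.lift_ι _ _ _ v
  | hadd x y hx hy => rw [map_add, map_add, hx, hy, map_add]
  | hsmul r x hx => rw [map_smul, map_smul, hx, map_smul]
  | hmul x y hx hy => rw [map_mul, map_mul, hx, hy, inl_mul]

theorem snd_homOfDummy_d {m : M} (hm : ∀ v, ⁅FreePreLie.ι k V v, m⁆ = 0) (x : FreePreLie k V) :
    snd (homOfDummy m (d k V x : GradedFree k V)) = ⁅x, m⁆ := by
  induction x using FreePreLie.induction with
  | hι v => rw [hm, d_ι, ZeroMemClass.coe_zero, map_zero, map_zero]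
  | hadd x y hx hy => simp only [map_add, Submodule.coe_add, hx, hy, add_lie]
  | hsmul r x hx => simp only [map_smul, Submodule.coe_smul, snd_smul, hx, smul_lie]
  | hmul x y hx _ =>
    have hassoc : snd (associator (inr k m) (inl k x) (inl k y) : SquareZero (FreePreLie k V) M) =
        ⁅y, ⁅x, m⁆⁆ + ⁅x * y, m⁆ := by
      rw [snd_associator, fst_inl, fst_inl, snd_inr]
    rw [associator_apply] at hassoc
    simp only [coe_d_mul, associator_apply, map_add, map_sub, map_mul, homOfDummy_incl,
      homOfDummy_dummy] at hassoc ⊢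
    rw [hassoc, snd_mul, snd_mul, hx, fst_inl, snd_inl, lie_zero]
    abel

end Differential

end SquareZero

section Theorem

variable {k : Type u} [CommRing k] {V : Type v} [AddCommGroup V] [Module k V]

theorem lie_eq_zero_of_d_eq_zero {M : Type*} [AddCommGroup M] [Module k M]
    [LieRingModule (FreePreLie k V) M] [LieModule k (FreePreLie k V) M] {m : M}
    (hm : ∀ v, ⁅FreePreLie.ι k V v, m⁆ = 0) {x : FreePreLie k V} (hx : d k V x = 0) :
    ⁅x, m⁆ = 0 := by
  rw [← SquareZero.snd_homOfDummy_d hm x, hx, ZeroMemClass.coe_zero, map_zero, map_zero]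

theorem ker_d_le_lieElements [Module.Free k (FreePreLie k V ⧸ (lieElements k V).toSubmodule)] :
    LinearMap.ker (d k V) ≤ (lieElements k V).toSubmodule := fun x hx => by
  obtain ⟨M, _, _, _, _, m, hm⟩ :=
    InducedModule.exists_lieModule_annihilator_eq (lieElements k V)
  have hV (v : V) : ⁅FreePreLie.ι k V v, m⁆ = 0 :=
    (hm _).2 (LieSubalgebra.subset_lieSpan ⟨v, rfl⟩)
  exact (hm x).1 (lie_eq_zero_of_d_eq_zero hV hx)

end Theorem

end PreLie

end

theorem mainTheorem1_general (k : Type*) [CommRing k] (V : Type*) [AddCommGroup V] [Module k V]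
    [Module.Free k (PreLie.FreePreLie k V ⧸ (PreLie.lieElements k V).toSubmodule)] :
    (PreLie.lieElements k V).toSubmodule = LinearMap.ker (PreLie.d k V) :=
  le_antisymm PreLie.lieElements_le_ker_d PreLie.ker_d_le_lieElements

theorem mainTheorem1 (k : Type*) [Field k] [CharZero k] (V : Type*) [AddCommGroup V] [Module k V] :
    (PreLie.lieElements k V).toSubmodule = LinearMap.ker (PreLie.d k V) :=
  mainTheorem1_general k V
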